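/- Setting. For integers $d\ge 2$, $1\le r\le d$ and a real $0<\rho<1$, and for $I\subseteq\{1,\dots,d\}$ with $|I|=r$, let $\mu_{I,\rho}$ be the probability distribution on $\{-1,1\}^d$ with $\mu_{I,\rho}(x)=2^{-d}\bigl(1+\rho\prod_{i\in I}x_i\bigr)$. Let $\mathcal I_r=\{I\subseteq\{1,\dots,d\}:|I|=r\}$ and $\mathcal P_{\mathcal I_r,\rho}=\{\mu_{I,\rho}: I\in\mathcal I_r\}$. An $(m,n)$-protocol is a (randomized, arbitrarily interactive) broadcast communication protocol between $m$ parties, each of which holds $n$ points of $\{-1,1\}^d$; the bits sent so far (and the protocol's randomness) determine who speaks next, what is sent depends on the speaker's own input, the history and the randomness, and the output is determined by the transcript and the randomness. Its communication complexity is the maximal total number of bits sent, over all inputs and all values of the randomness. It identifies $\mu\in\mathcal P_{\mathcal I_r,\rho}$ with error $1/3$ if, for every $I\in\mathcal I_r$, when all $mn$ points are drawn independently from $\mu_{I,\rho}$ the protocol outputs $I$ with probability at least $2/3$. Theorem. There exist numerical constants $C',C''>0$, a function $C:\mathbb N\to(0,\infty)$, and positive numbers $C(r,\varepsilon)$ depending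 only on $r$ and $\varepsilon$, such that the following holds. Let $2\le r\le d-1$, $k=\binom dr$, let $m\ge 1$ and $n$ be integers, and let $0<\rho<1$ satisfy $\rho\le (n\ln k)^{-1/2}/C'$. Assume that either 1. $n\ge C(r)\,d^{3r}$, or 2. $r$ is odd and $n\ge C(r,\varepsilon)\,d^{(2+\varepsilon)r}$ for some $0<\varepsilon<1$. Then any $(m,n)$-protocol identifying $\mu\in\mathcal P_{\mathcal I_r,\rho}$ with error $1/3$ has communication complexity at least $$\frac{k}{C''\rho^2 n\log\bigl(k^2/(n\rho^2)\bigr)}.$$ -/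

import Mathlib

open MeasureTheory
open scoped ENNReal

universe u v w

/-- A deterministic broadcast (blackboard) protocol between `m` parties, each holding a private
input in `X`, with outputs in `O`. A node of the tree is a message history; the history determines
which party speaks next, and that party broadcasts one bit, computed from her own input. A longer
message is a run of consecutive bits by the same speaker. At a leaf the protocol stops, and the
output is determined by the history. Number of messages and of rounds are unrestricted. -/
inductive ProtocolTree (m : ℕ) (X : Type v) (O : Type w) : Type (max v w)
  | leaf (out : O) : ProtocolTree m X O
  | speak (speaker : Fin m) (bit : X → Bool) (next : Bool → ProtocolTree m X O) :
      ProtocolTree m X O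

namespace ProtocolTree

variable {m : ℕ} {X : Type v} {O : Type w}

/-- The output when party `j` has input `x j`. -/
def output : ProtocolTree m X O → (Fin m → X) → O
  | leaf out, _ => out
  | speak j bit next, x => output (next (bit (x j))) x

/-- The number of bits broadcast when party `j` has input `x j`. -/
def bitsSent : ProtocolTree m X O → (Fin m → X) → ℕ
  | leaf _, _ => 0
  | speak j bit next, x => bitsSent (next (bit (x j))) x + 1

end ProtocolTree

/-- A randomized protocol: a random seed, independent of the inputs and available to all parties,
selects the deterministic protocol that is run. Private randomness is the special case in which
the seed is a tuple and each party's messages use only her own component of it. -/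
structure RandomizedProtocol (m : ℕ) (X : Type v) [MeasurableSpace X] (O : Type w) :
    Type (max (u + 1) v w) where
  Seed : Type u
  [seedSpace : MeasurableSpace Seed]
  seedLaw : Measure Seed
  [isProbabilityMeasure_seedLaw : IsProbabilityMeasure seedLaw]
  tree : Seed → ProtocolTree m X O
  measurableSet_output : ∀ o : O,
    MeasurableSet {p : Seed × (Fin m → X) | (tree p.1).output p.2 = o}

attribute [instance] RandomizedProtocol.seedSpace RandomizedProtocol.isProbabilityMeasure_seedLaw

namespace RandomizedProtocol

/-- Communication complexity: the maximal number of bits sent, over all inputs and all values of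
the randomness (`⊤` if there is no bound). -/
noncomputable def commComplexity {m : ℕ} {X : Type v} [MeasurableSpace X] {O : Type w}
    (π : RandomizedProtocol.{u, v, w} m X O) : ℕ∞ :=
  ⨆ (s : π.Seed) (x : Fin m → X), ((π.tree s).bitsSent x : ℕ∞)

/-- The `(m, n)`-protocol `π` identifies the members of the family `μ` with error `ε`: whenever all
`m` parties receive independent sets of `n` i.i.d. samples from `μ i`, the output is `i` with
probability at least `1 - ε` (over the samples and the randomness of the protocol). -/
def Identifies {m n : ℕ} {Ω : Type v} [MeasurableSpace Ω] {ι : Type w}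
    (π : RandomizedProtocol.{u, v, w} m (Fin n → Ω) ι) (μ : ι → Measure Ω) (ε : ℝ) : Prop :=
  ∀ i : ι, 1 - ε ≤
    (π.seedLaw.prod (Measure.pi fun _ : Fin m => Measure.pi fun _ : Fin n => μ i)).real
      {p | (π.tree p.1).output p.2 = i}

end RandomizedProtocol

/-- Every subset of `{-1, 1}` is measurable. -/
instance intUnits_measurableSingletonClass : MeasurableSingletonClass ℤˣ :=
  ⟨fun x => ⟨{x.val}, MeasurableSet.singleton _, by ext y; simp [Units.ext_iff]⟩⟩

/-- The distribution on `{-1, 1}^d` (`ℤˣ` is the set `{1, -1}` of units of `ℤ`) that gives the point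
`x` the probability `2 ^ (-d) * (1 + ρ * ∏ i ∈ I, x i)`, for `0 ≤ ρ ≤ 1` and nonempty `I`. -/
noncomputable def corrMeasure {d : ℕ} (ρ : ℝ) (I : Finset (Fin d)) : Measure (Fin d → ℤˣ) :=
  Measure.count.withDensity fun x =>
    ENNReal.ofReal ((2 : ℝ)⁻¹ ^ d * (1 + ρ * ((∏ i ∈ I, x i : ℤˣ) : ℤ)))

/-- The index set of order-`r` correlations: the `r`-element subsets of the coordinates. -/
abbrev OrderSubsets (d r : ℕ) : Type := {I : Finset (Fin d) // I.card = r}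

/-! Write `k` for the number of subsets and `t = n * ρ ^ 2`. Under uniform inputs the output guesses
every index with total probability 1; the proof shows that a party's `n` samples reveal so little
that `B` bits can raise this total only by a multiple of `B * t * log (k ^ 2 / t)` (plus constants),
while identification requires `2 * k / 3`.

Single party. The likelihood ratio of `n` samples against uniform is a martingale, frozen once it
leaves the band of width `θ` around 1. Its increments then have bounded predictable coefficients,
and distinct parities are orthogonal, so linear combinations of the `k` stopped ratios have Gaussian
exponential moments with variance proxy of order `t` (`sum_exp_sum_parityRatio_le`). By Jensen's
inequality, conditioning on an event `A` gives mean deviations whose squares sum to at most `κ * log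
(1 / P A)`, where `κ = 16 * t + θ' ^ 2` (`sum_sq_average_le`). This is where `k ^ 2 ≤ n` enters;
both alternatives on `n` imply it.

Protocol. A leaf is a rectangle. There `leaf_inequality` bounds the gain in the probability of
answering `i` by the sum over the parties of squared deviations; summed over `i` and over leaves
this is at most `κ` times the entropy of the leaf, hence at most `κ * log 2` times the expected
number of bits (`sum_outputSum_le`).

Stopping. Exchanging true laws for stopped ones costs the tail probability `η` once per party that
speaks, not once per party (`outputSum_le_outputSum_add`), so `m` never appears. The choice `θ ^ 2 =
8 * t * log (k ^ 2 / t)` makes `η` of order `t / k ^ 2`, which is the source of the logarithm in the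
bound. -/

namespace ProtocolTree

/-! ### Product masses and entropy on the leaves of a protocol. -/

variable {m : ℕ} {X : Type v} {O : Type w}

/-- The sum of `f A o` over the leaves of the tree, where `A` is the rectangle of those inputs in
the given rectangle that lead to the leaf, and `o` is the output there. -/
noncomputable def leafSum (f : (Fin m → Finset X) → O → ℝ) :
    ProtocolTree m X O → (Fin m → Finset X) → ℝ
  | leaf out, A => f A out
  | speak j bit next, A =>
      ∑ b : Bool, leafSum f (next b) (Function.update A j ((A j).filter fun x => bit x = b))

theorem leafSum_mono {f g : (Fin m → Finset X) → O → ℝ} (h : ∀ A o, f A o ≤ g A o)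
    (T : ProtocolTree m X O) (A : Fin m → Finset X) : leafSum f T A ≤ leafSum g T A := by
  induction T generalizing A with
  | leaf o => exact h A o
  | speak j bit next ih => exact Finset.sum_le_sum fun b _ => ih b _

theorem leafSum_add (f g : (Fin m → Finset X) → O → ℝ)
    (T : ProtocolTree m X O) (A : Fin m → Finset X) :
    leafSum (fun A o => f A o + g A o) T A = leafSum f T A + leafSum g T A := by
  induction T generalizing A with
  | leaf o => rfl
  | speak j bit next ih => simp only [leafSum, ih, Finset.sum_add_distrib]

theorem leafSum_const_mul (c : ℝ) (f : (Fin m → Finset X) → O → ℝ)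
    (T : ProtocolTree m X O) (A : Fin m → Finset X) :
    leafSum (fun A o => c * f A o) T A = c * leafSum f T A := by
  induction T generalizing A with
  | leaf o => rfl
  | speak j bit next ih => simp only [leafSum, ih, Finset.mul_sum]

theorem leafSum_sum {ι : Type*} (s : Finset ι) (f : ι → (Fin m → Finset X) → O → ℝ)
    (T : ProtocolTree m X O) (A : Fin m → Finset X) :
    leafSum (fun A o => ∑ i ∈ s, f i A o) T A = ∑ i ∈ s, leafSum (f i) T A := by
  induction T generalizing A with
  | leaf o => rfl
  | speak j bit next ih =>
    simp only [leafSum, ih]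
    exact Finset.sum_comm

theorem piFinset_update_filter (A : Fin m → Finset X) (j : Fin m) (p : X → Prop)
    [DecidablePred p] :
    Fintype.piFinset (Function.update A j ((A j).filter p)) =
      (Fintype.piFinset A).filter fun x => p (x j) := by
  ext x
  simp only [Fintype.mem_piFinset, Finset.mem_filter]
  constructor
  · intro h
    have hj := h j
    simp only [Function.update_self, Finset.mem_filter] at hj
    refine ⟨fun i => ?_, hj.2⟩
    by_cases hi : i = j
    · subst hi; exact hj.1
    · simpa [hi] using h i
  · rintro ⟨h, hp⟩ i
    by_cases hi : i = j
    · subst hi; simp [h i, hp]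
    · simpa [hi] using h i

theorem sum_piFinset_split (A : Fin m → Finset X) (j : Fin m) (bit : X → Bool)
    (F : (Fin m → X) → ℝ) :
    ∑ b : Bool, ∑ x ∈ Fintype.piFinset
        (Function.update A j ((A j).filter fun x => bit x = b)), F x =
      ∑ x ∈ Fintype.piFinset A, F x := by
  simp only [piFinset_update_filter]
  exact Finset.sum_fiberwise _ _ _

/-- A bit cuts only its speaker's side of the rectangle, so product masses add up over the two
children. No sign condition is placed on `v`: signed factors are needed for the linear terms in
`sum_outputSum_le`. -/
theorem leafSum_prod (v : Fin m → X → ℝ) (g : O → ℝ) (T : ProtocolTree m X O)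
    (A : Fin m → Finset X) :
    leafSum (fun A o => (∏ j, ∑ x ∈ A j, v j x) * g o) T A =
      ∑ x ∈ Fintype.piFinset A, (∏ j, v j (x j)) * g (T.output x) := by
  induction T generalizing A with
  | leaf o => simp only [leafSum, output, Finset.prod_univ_sum, Finset.sum_mul]
  | speak j bit next ih =>
    simp only [leafSum, ih, output]
    rw [← sum_piFinset_split A j bit]
    refine Finset.sum_congr rfl fun b _ => Finset.sum_congr rfl fun x hx => ?_
    rw [piFinset_update_filter, Finset.mem_filter] at hx
    rw [hx.2]

/-- Midpoint concavity: for a given total mass, the even split gains the most entropy. -/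
theorem negMulLog_add_le {a b : ℝ} (ha : 0 ≤ a) (hb : 0 ≤ b) :
    Real.negMulLog a + Real.negMulLog b ≤ Real.negMulLog (a + b) + Real.log 2 * (a + b) := by
  have h := Real.concaveOn_negMulLog.2 (Set.mem_Ici.2 ha) (Set.mem_Ici.2 hb)
    (by norm_num : (0 : ℝ) ≤ 1 / 2) (by norm_num : (0 : ℝ) ≤ 1 / 2) (by norm_num)
  simp only [smul_eq_mul] at h
  have e : Real.negMulLog (1 / 2 * a + 1 / 2 * b) =
      1 / 2 * Real.negMulLog (a + b) + 1 / 2 * (Real.log 2 * (a + b)) := by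
    rw [show 1 / 2 * a + 1 / 2 * b = (1 / 2 : ℝ) * (a + b) by ring, Real.negMulLog_mul]
    simp only [Real.negMulLog, one_div, Real.log_inv]
    ring
  linarith

/-- The entropy of the leaf is at most `log 2` times the expected number of bits. -/
theorem leafSum_negMulLog_le (v : Fin m → X → ℝ) (hv : ∀ j x, 0 ≤ v j x)
    (T : ProtocolTree m X O) (A : Fin m → Finset X) :
    leafSum (fun A _ => Real.negMulLog (∏ j, ∑ x ∈ A j, v j x)) T A ≤
      Real.negMulLog (∏ j, ∑ x ∈ A j, v j x) +
        Real.log 2 * ∑ x ∈ Fintype.piFinset A, (∏ j, v j (x j)) * (T.bitsSent x : ℝ) := by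
  induction T generalizing A with
  | leaf o => simp [leafSum, bitsSent]
  | speak j bit next ih =>
    simp only [leafSum]
    refine (Finset.sum_le_sum fun b _ => ih b _).trans ?_
    rw [Finset.sum_add_distrib, ← Finset.mul_sum]
    have e1 : ∑ b : Bool, ∑ x ∈ Fintype.piFinset
          (Function.update A j ((A j).filter fun x => bit x = b)),
          (∏ i, v i (x i)) * ((next b).bitsSent x : ℝ) =
        ∑ x ∈ Fintype.piFinset A, (∏ i, v i (x i)) * ((next (bit (x j))).bitsSent x : ℝ) := by
      rw [← sum_piFinset_split A j bit]
      refine Finset.sum_congr rfl fun b _ => Finset.sum_congr rfl fun x hx => ?_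
      rw [piFinset_update_filter, Finset.mem_filter] at hx
      rw [hx.2]
    have e2 : ∑ x ∈ Fintype.piFinset A, (∏ i, v i (x i)) *
          ((speak j bit next).bitsSent x : ℝ) =
        ∑ x ∈ Fintype.piFinset A, (∏ i, v i (x i)) * ((next (bit (x j))).bitsSent x : ℝ) +
          ∏ i, ∑ x ∈ A i, v i x := by
      simp only [bitsSent, Nat.cast_add, Nat.cast_one, mul_add, mul_one,
        Finset.sum_add_distrib, Finset.prod_univ_sum]
    have e3 : ∑ b : Bool, ∏ i, ∑ x ∈ Function.update A j
          ((A j).filter fun x => bit x = b) i, v i x = ∏ i, ∑ x ∈ A i, v i x := by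
      simp only [Finset.prod_univ_sum]
      exact sum_piFinset_split A j bit _
    have h0 : ∀ B : Fin m → Finset X, 0 ≤ ∏ i, ∑ x ∈ B i, v i x := fun B =>
      Finset.prod_nonneg fun i _ => Finset.sum_nonneg fun x _ => hv i x
    rw [e1, e2, ← e3]
    simp only [Fintype.sum_bool]
    -- By `e3` the children's masses add up to the mass of the node, and `e2` charges that same mass
    -- for the bit sent here.
    have := negMulLog_add_le (h0 (Function.update A j ((A j).filter fun x => bit x = true)))
      (h0 (Function.update A j ((A j).filter fun x => bit x = false)))
    linarith

/-! ### Replacing input laws party by party along the tree. -/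

section Hybrid

theorem prod_update_single [DecidableEq X] (v : Fin m → X → ℝ) (j : Fin m) (a : X) (x : Fin m → X) :
    ∏ i, Function.update v j (Pi.single a 1) i (x i) =
      if x j = a then ∏ i ∈ Finset.univ.erase j, v i (x i) else 0 := by
  rw [← Finset.mul_prod_erase _ _ (Finset.mem_univ j)]
  have : ∏ i ∈ Finset.univ.erase j, Function.update v j (Pi.single a 1) i (x i) =
      ∏ i ∈ Finset.univ.erase j, v i (x i) :=
    Finset.prod_congr rfl fun i hi => by
      rw [Function.update_of_ne (Finset.ne_of_mem_erase hi)]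
  rw [this, Function.update_self]
  by_cases h : x j = a
  · simp [h]
  · simp [h]

variable [Fintype X]

/-- The expectation of `g` at the output when the inputs have the independent laws `v j`. -/
noncomputable def outputSum (g : O → ℝ) (T : ProtocolTree m X O) (v : Fin m → X → ℝ) : ℝ :=
  ∑ x : Fin m → X, (∏ j, v j (x j)) * g (T.output x)

/-- The expected number of bits when the inputs have the independent laws `v j`. -/
noncomputable def bitsSum (T : ProtocolTree m X O) (v : Fin m → X → ℝ) : ℝ :=
  ∑ x : Fin m → X, (∏ j, v j (x j)) * (T.bitsSent x : ℝ)

theorem sum_prod_eq_one {v : Fin m → X → ℝ} (hv : ∀ j, ∑ x, v j x = 1) :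
    ∑ x : Fin m → X, ∏ j, v j (x j) = 1 := by
  have := Finset.prod_univ_sum (fun _ : Fin m => (Finset.univ : Finset X)) v
  rw [Fintype.piFinset_univ] at this
  rw [← this]
  simp [hv]

variable [DecidableEq X]

/-- Conditioning on the whole input of the speaker, not just her bit, leaves a product law with a
point mass, so an induction over the tree never leaves product laws. -/
theorem sum_prod_mul_eq_sum_update (v : Fin m → X → ℝ) (j : Fin m) (F : (Fin m → X) → ℝ) :
    ∑ x : Fin m → X, (∏ i, v i (x i)) * F x =
      ∑ a, v j a * ∑ x : Fin m → X, (∏ i, Function.update v j (Pi.single a 1) i (x i)) * F x := by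
  simp only [Finset.mul_sum]
  rw [Finset.sum_comm]
  refine Finset.sum_congr rfl fun x _ => ?_
  simp only [prod_update_single]
  rw [Finset.sum_eq_single (x j)]
  · rw [if_pos rfl, ← mul_assoc,
      Finset.mul_prod_erase _ (fun i => v i (x i)) (Finset.mem_univ j)]
  · intro a _ ha
    rw [if_neg (Ne.symm ha)]; simp
  · simp

theorem sum_prod_update_single_congr (v : Fin m → X → ℝ) (j : Fin m) (a : X)
    {F G : (Fin m → X) → ℝ} (h : ∀ x, x j = a → F x = G x) :
    ∑ x : Fin m → X, (∏ i, Function.update v j (Pi.single a 1) i (x i)) * F x =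
      ∑ x : Fin m → X, (∏ i, Function.update v j (Pi.single a 1) i (x i)) * G x := by
  refine Finset.sum_congr rfl fun x _ => ?_
  rw [prod_update_single]
  by_cases hx : x j = a
  · rw [h x hx]
  · rw [if_neg hx]; simp

/-- Replacing the law `p` of inputs by a law `q` raises the expected output by at most `η` for each
party that speaks, if it raises no expectation of a function with values in `[0, 1]` by more. -/
theorem outputSum_le_outputSum_add {p q : X → ℝ} {η : ℝ} (hη : 0 ≤ η)
    (hp0 : ∀ x, 0 ≤ p x) (hq0 : ∀ x, 0 ≤ q x) (hp1 : ∑ x, p x = 1) (hq1 : ∑ x, q x = 1)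
    (hpq : ∀ f : X → ℝ, (∀ x, 0 ≤ f x) → (∀ x, f x ≤ 1) →
      ∑ x, p x * f x ≤ ∑ x, q x * f x + η)
    {g : O → ℝ} (hg0 : ∀ o, 0 ≤ g o) (hg1 : ∀ o, g o ≤ 1)
    (T : ProtocolTree m X O) (v w : Fin m → X → ℝ)
    (hvw : ∀ j, (∃ a, v j = Pi.single a 1 ∧ w j = Pi.single a 1) ∨ (v j = p ∧ w j = q)) :
    outputSum g T v ≤ outputSum g T w + η * bitsSum T v := by
  have hv1 : ∀ v w : Fin m → X → ℝ, (∀ j, (∃ a, v j = Pi.single a 1 ∧ w j = Pi.single a 1) ∨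
      (v j = p ∧ w j = q)) → ∀ j, ∑ x, v j x = 1 ∧ ∑ x, w j x = 1 ∧
        (∀ x, 0 ≤ v j x) ∧ (∀ x, 0 ≤ w j x) := by
    intro v w h j
    rcases h j with ⟨a, h1, h2⟩ | ⟨h1, h2⟩
    · have : ∀ x, 0 ≤ (Pi.single a 1 : X → ℝ) x := fun x => by
        by_cases hx : x = a
        · subst hx; simp
        · simp [hx]
      rw [h1, h2]; simp [this]
    · rw [h1, h2]; exact ⟨hp1, hq1, hp0, hq0⟩
  induction T generalizing v w with
  | leaf o =>
    have a1 := sum_prod_eq_one fun j => (hv1 v w hvw j).1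
    have a2 := sum_prod_eq_one fun j => (hv1 v w hvw j).2.1
    simp only [outputSum, bitsSum, output, bitsSent, ← Finset.sum_mul, a1, a2]
    simp
  | speak j bit next ih =>
    have hstep : ∀ (v : Fin m → X → ℝ) (a : X),
        outputSum g (speak j bit next) (Function.update v j (Pi.single a 1)) =
          outputSum g (next (bit a)) (Function.update v j (Pi.single a 1)) := fun v a =>
      sum_prod_update_single_congr v j a fun x hx => by simp only [output, hx]
    have hbits : ∀ (v : Fin m → X → ℝ) (a : X), (∀ i, ∑ x, v i x = 1) →
        bitsSum (speak j bit next) (Function.update v j (Pi.single a 1)) =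
          bitsSum (next (bit a)) (Function.update v j (Pi.single a 1)) + 1 := fun v a h => by
      have h1 : ∀ i, ∑ x, Function.update v j (Pi.single a 1) i x = 1 := fun i => by
        by_cases hi : i = j
        · subst hi; simp
        · rw [Function.update_of_ne hi]; exact h i
      unfold bitsSum
      rw [sum_prod_update_single_congr (G := fun x => ((next (bit a)).bitsSent x : ℝ) + 1) v j a
        fun x hx => by simp only [bitsSent, hx]; push_cast; rfl]
      simp only [mul_add, Finset.sum_add_distrib, mul_one, sum_prod_eq_one h1]
    have hup : ∀ a, ∀ i, (∃ a', Function.update v j (Pi.single a 1) i = Pi.single a' 1 ∧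
        Function.update w j (Pi.single a 1) i = Pi.single a' 1) ∨
        (Function.update v j (Pi.single a 1) i = p ∧
          Function.update w j (Pi.single a 1) i = q) := fun a i => by
      by_cases hi : i = j
      · subst hi; exact Or.inl ⟨a, by simp, by simp⟩
      · simpa only [Function.update_of_ne hi] using hvw i
    -- A speaker with a point mass has the same input in both laws, so nothing is lost. Otherwise
    -- her law is exchanged here, at cost `η`, paid for by the present bit.
    rcases hvw j with ⟨a, h1, h2⟩ | ⟨h1, h2⟩
    · have ev : Function.update v j (Pi.single a 1) = v := by rw [← h1, Function.update_eq_self]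
      have ew : Function.update w j (Pi.single a 1) = w := by rw [← h2, Function.update_eq_self]
      have := ih (bit a) v w hvw
      have s1 := hstep v a
      have s2 := hstep w a
      have s3 := hbits v a fun i => (hv1 v w hvw i).1
      rw [ev] at s1 s3
      rw [ew] at s2
      rw [s1, s2, s3]
      linarith
    · have d1 : outputSum g (speak j bit next) v =
          ∑ a, p a * outputSum g (next (bit a)) (Function.update v j (Pi.single a 1)) := by
        rw [outputSum, sum_prod_mul_eq_sum_update v j, h1]
        exact Finset.sum_congr rfl fun a _ => congrArg (p a * ·) (hstep v a)
      have d2 : outputSum g (speak j bit next) w =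
          ∑ a, q a * outputSum g (next (bit a)) (Function.update w j (Pi.single a 1)) := by
        rw [outputSum, sum_prod_mul_eq_sum_update w j, h2]
        exact Finset.sum_congr rfl fun a _ => congrArg (q a * ·) (hstep w a)
      have d3 : bitsSum (speak j bit next) v =
          ∑ a, p a * (bitsSum (next (bit a)) (Function.update v j (Pi.single a 1)) + 1) := by
        rw [bitsSum, sum_prod_mul_eq_sum_update v j, h1]
        exact Finset.sum_congr rfl fun a _ =>
          congrArg (p a * ·) (hbits v a fun i => (hv1 v w hvw i).1)
      have hnn : ∀ a (x : Fin m → X), 0 ≤ ∏ i, Function.update w j (Pi.single a 1) i (x i) := fun a x =>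
        Finset.prod_nonneg fun i _ => (hv1 _ _ (hup a) i).2.2.2 _
      -- The test function is the expected output, given the speaker's input, under the laws `w` of
      -- the others; the induction hypothesis passes from `v` to `w` for each such input.
      have key := hpq
        (fun a => outputSum g (next (bit a)) (Function.update w j (Pi.single a 1)))
        (fun a => Finset.sum_nonneg fun (x : Fin m → X) _ => mul_nonneg (hnn a x) (hg0 _))
        (fun a => (Finset.sum_le_sum fun (x : Fin m → X) _ =>
          mul_le_of_le_one_right (hnn a x) (hg1 _)).trans_eq
            (sum_prod_eq_one fun i => (hv1 _ _ (hup a) i).2.1))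
      have := Finset.sum_le_sum fun a (_ : a ∈ Finset.univ) =>
        mul_le_mul_of_nonneg_left (ih (bit a) _ _ (hup a)) (hp0 a)
      rw [d1, d2, d3]
      simp only [mul_add, Finset.sum_add_distrib, mul_one, hp1] at this ⊢
      have e : ∑ a, p a * (η * bitsSum (next (bit a)) (Function.update v j (Pi.single a 1))) =
          η * ∑ a, p a * bitsSum (next (bit a)) (Function.update v j (Pi.single a 1)) := by
        rw [Finset.mul_sum]
        exact Finset.sum_congr rfl fun a _ => by ring
      rw [e] at this
      linarith

end Hybrid

end ProtocolTree

/-! ### The stopped likelihood ratio as a bounded martingale. -/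

/-- The likelihood ratio `M * ∏ i, (1 + ρ * z i)`, stopped when it is farther than `θ` from `1`. -/
noncomputable def stoppedLikelihood (ρ θ : ℝ) : (n : ℕ) → (Fin n → ℝ) → ℝ → ℝ
  | 0, _, M => M
  | n + 1, z, M =>
      stoppedLikelihood ρ θ n (Fin.tail z) (if |M - 1| ≤ θ then M * (1 + ρ * z 0) else M)

namespace stoppedLikelihood

variable {ρ θ : ℝ}

theorem eq_of_lt {n : ℕ} (z : Fin n → ℝ) {M : ℝ} (h : θ < |M - 1|) :
    stoppedLikelihood ρ θ n z M = M := by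
  induction n with
  | zero => rfl
  | succ n ih => rw [stoppedLikelihood, if_neg (not_le.2 h), ih]

/-- A value outside the band is frozen there, so a final value inside the band certifies that no
factor was skipped. -/
theorem eq_prod {n : ℕ} (z : Fin n → ℝ) {M : ℝ} (h : |stoppedLikelihood ρ θ n z M - 1| ≤ θ) :
    stoppedLikelihood ρ θ n z M = M * ∏ i, (1 + ρ * z i) := by
  induction n generalizing M with
  | zero => simp [stoppedLikelihood]
  | succ n ih =>
    by_cases hM : |M - 1| ≤ θ
    · rw [stoppedLikelihood, if_pos hM] at h ⊢
      rw [ih _ h, Fin.prod_univ_succ, mul_assoc]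
      rfl
    · rw [eq_of_lt z (not_le.1 hM)] at h
      exact absurd h hM

/-- A factor is applied only while `|M| ≤ 1 + θ`, so the overshoot is at most `ρ * (1 + θ)`. -/
theorem abs_sub_one_le {n : ℕ} {θ' : ℝ} (hρ : 0 ≤ ρ) (hθ' : θ + ρ * (1 + θ) ≤ θ')
    (z : Fin n → ℝ) (hz : ∀ i, |z i| ≤ 1) {M : ℝ} (hM : |M - 1| ≤ θ') :
    |stoppedLikelihood ρ θ n z M - 1| ≤ θ' := by
  induction n generalizing M with
  | zero => exact hM
  | succ n ih =>
    rw [stoppedLikelihood]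
    refine ih _ (fun i => hz _) ?_
    split_ifs with h
    · have e : M * (1 + ρ * z 0) - 1 = (M - 1) + ρ * (M * z 0) := by ring
      have h1 : |M| ≤ 1 + θ := by
        have := abs_add_le (M - 1) 1
        rw [sub_add_cancel, abs_one] at this
        linarith
      rw [e]
      calc |(M - 1) + ρ * (M * z 0)| ≤ |M - 1| + |ρ * (M * z 0)| := abs_add_le _ _
        _ = |M - 1| + ρ * (|M| * |z 0|) := by rw [abs_mul, abs_mul, abs_of_nonneg hρ]
        _ ≤ θ + ρ * ((1 + θ) * 1) := by
          gcongr
          · exact (abs_nonneg _).trans h1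
          · exact hz 0
        _ ≤ θ' := by linarith
    · exact hM

variable {Y : Type*}

theorem cons_comp {n : ℕ} (χ : Y → ℝ) (y : Y) (x : Fin n → Y) (M : ℝ) :
    stoppedLikelihood ρ θ (n + 1) (fun l => χ ((Fin.cons y x : Fin (n + 1) → Y) l)) M =
      stoppedLikelihood ρ θ n (fun l => χ (x l))
        (M + ρ * (if |M - 1| ≤ θ then M else 0) * χ y) := by
  rw [stoppedLikelihood]
  congr 1
  split_ifs
  · simp only [Fin.cons_zero]; ring
  · ring

variable [Fintype Y]

theorem sum_fin_succ (n : ℕ) (F : (Fin (n + 1) → Y) → ℝ) :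
    ∑ x, F x = ∑ y, ∑ x : Fin n → Y, F (Fin.cons y x) := by
  rw [← (Fin.consEquiv fun _ => Y).sum_comp, Fintype.sum_prod_type]
  rfl

theorem sum_eq (χ : Y → ℝ) (hχ : ∑ y, χ y = 0) (n : ℕ) (M : ℝ) :
    ∑ x : Fin n → Y, stoppedLikelihood ρ θ n (fun l => χ (x l)) M = Fintype.card Y ^ n * M := by
  induction n generalizing M with
  | zero => simp [stoppedLikelihood]
  | succ n ih =>
    rw [sum_fin_succ]
    simp only [cons_comp, ih, ← Finset.mul_sum, Finset.sum_add_distrib, hχ]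
    simp only [Finset.sum_const, Finset.card_univ, nsmul_eq_mul]
    ring

/-- A bound on the exponential moments of the increments gives one for stopped likelihoods. -/
theorem sum_exp_le {ι : Type*} [Fintype ι] (hρ : 0 ≤ ρ) (χ : ι → Y → ℝ) (b : ι → ℝ)
    {K : ℝ} (hK : ∀ c : ι → ℝ, (∀ i, |c i| ≤ ρ * (1 + θ) * |b i|) →
      ∑ y, Real.exp (∑ i, c i * χ i y) ≤ Fintype.card Y * Real.exp K)
    (hθ : 0 ≤ θ) (n : ℕ) (M : ι → ℝ) :
    ∑ x : Fin n → Y, Real.exp (∑ i, b i * stoppedLikelihood ρ θ n (fun l => χ i (x l)) (M i)) ≤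
      Fintype.card Y ^ n * Real.exp (∑ i, b i * M i + n * K) := by
  induction n generalizing M with
  | zero => simp [stoppedLikelihood]
  | succ n ih =>
    rw [sum_fin_succ]
    simp only [cons_comp]
    -- The coefficient of the next increment depends only on the past. Stopping bounds it by `1 +
    -- θ`, which lets `hK` apply whatever the history.
    set H : ι → ℝ := fun i => if |M i - 1| ≤ θ then M i else 0 with hH
    have hHb : ∀ i, |H i| ≤ 1 + θ := fun i => by
      simp only [hH]
      split_ifs with h
      · have := abs_add_le (M i - 1) 1
        rw [sub_add_cancel, abs_one] at this
        linarith
      · simpa using by linarith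
    have h1 := hK (fun i => b i * (ρ * H i)) fun i => by
      rw [abs_mul, abs_mul, abs_of_nonneg hρ, mul_comm |b i|]
      gcongr
      exact hHb i
    calc ∑ y, ∑ x : Fin n → Y, Real.exp (∑ i, b i *
          stoppedLikelihood ρ θ n (fun l => χ i (x l)) (M i + ρ * H i * χ i y))
        ≤ ∑ y, Fintype.card Y ^ n *
            Real.exp (∑ i, b i * (M i + ρ * H i * χ i y) + n * K) :=
          Finset.sum_le_sum fun y _ => ih _
      _ = Fintype.card Y ^ n * Real.exp (∑ i, b i * M i + n * K) *
            ∑ y, Real.exp (∑ i, b i * (ρ * H i) * χ i y) := by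
          rw [Finset.mul_sum]
          refine Finset.sum_congr rfl fun y _ => ?_
          rw [mul_assoc, ← Real.exp_add]
          congr 2
          simp only [mul_add, Finset.sum_add_distrib, mul_assoc]
          ring
      _ ≤ Fintype.card Y ^ n * Real.exp (∑ i, b i * M i + n * K) *
            (Fintype.card Y * Real.exp K) := by gcongr
      _ = Fintype.card Y ^ (n + 1) * Real.exp (∑ i, b i * M i + (n + 1 : ℕ) * K) := by
          rw [show ∑ i, b i * M i + ((n + 1 : ℕ) : ℝ) * K = (∑ i, b i * M i + n * K) + K by
            push_cast; ring, Real.exp_add _ K]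
          ring

end stoppedLikelihood

/-! ### Orthogonality and exponential moments of parities. -/

/-- The real-valued character `∏ i ∈ I, y i` on `{-1, 1}^d`. -/
noncomputable def parity {d : ℕ} (I : Finset (Fin d)) (y : Fin d → ℤˣ) : ℝ :=
  ((∏ i ∈ I, y i : ℤˣ) : ℤ)

namespace parity

variable {d : ℕ}

theorem eq_one_or (I : Finset (Fin d)) (y : Fin d → ℤˣ) : parity I y = 1 ∨ parity I y = -1 := by
  rcases Int.units_eq_one_or (∏ i ∈ I, y i) with h | h <;> simp [parity, h]

theorem abs_eq (I : Finset (Fin d)) (y : Fin d → ℤˣ) : |parity I y| = 1 := by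
  rcases eq_one_or I y with h | h <;> simp [h]

theorem update_neg_of_mem {I : Finset (Fin d)} {i : Fin d} (hi : i ∈ I) (y : Fin d → ℤˣ) :
    parity I (Function.update y i (-y i)) = -parity I y := by
  unfold parity
  rw [Finset.prod_update_of_mem hi, Finset.prod_eq_mul_prod_sdiff_singleton_of_mem hi]
  push_cast
  ring

theorem update_of_notMem {I : Finset (Fin d)} {i : Fin d} (hi : i ∉ I) (y : Fin d → ℤˣ) (a : ℤˣ) :
    parity I (Function.update y i a) = parity I y := by
  unfold parity
  rw [Finset.prod_update_of_notMem hi]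

theorem sum_eq_zero_of_flip (F : (Fin d → ℤˣ) → ℝ) (i : Fin d)
    (h : ∀ y, F (Function.update y i (-y i)) = -F y) : ∑ y, F y = 0 := by
  have hinv : Function.Involutive fun y : Fin d → ℤˣ => Function.update y i (-y i) := by
    intro y
    simp
  have := (Equiv.sum_comp hinv.toPerm F).symm
  simp only [Function.Involutive.coe_toPerm, h, Finset.sum_neg_distrib] at this
  linarith

theorem sum_eq_zero {I : Finset (Fin d)} (hI : I.Nonempty) : ∑ y, parity I y = 0 := by
  obtain ⟨i, hi⟩ := hI
  exact sum_eq_zero_of_flip _ i fun y => update_neg_of_mem hi y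

theorem sum_mul_eq_zero {I J : Finset (Fin d)} (h : I ≠ J) :
    ∑ y, parity I y * parity J y = 0 := by
  have : ∃ i, ¬ (i ∈ I ↔ i ∈ J) := by
    by_contra! hc
    exact h (Finset.ext hc)
  obtain ⟨i, hi⟩ := this
  refine sum_eq_zero_of_flip _ i fun y => ?_
  by_cases hI : i ∈ I
  · have hJ : i ∉ J := fun hJ => hi (by simp [hI, hJ])
    rw [update_neg_of_mem hI, update_of_notMem hJ]; ring
  · have hJ : i ∈ J := by tauto
    rw [update_neg_of_mem hJ, update_of_notMem hI]; ring

/-- One parity is a uniform sign, with moment `cosh c`; unlike for the joint bound below, `c` need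
not be small. -/
theorem sum_exp_mul_le {I : Finset (Fin d)} (hI : I.Nonempty) (c : ℝ) :
    ∑ y, Real.exp (c * parity I y) ≤ Fintype.card (Fin d → ℤˣ) * Real.exp (c ^ 2 / 2) := by
  have e : ∀ y, Real.exp (c * parity I y) = Real.cosh c + Real.sinh c * parity I y := by
    intro y
    rcases eq_one_or I y with h | h
    · rw [h, mul_one, mul_one, Real.cosh_add_sinh]
    · rw [h, mul_neg, mul_one, mul_neg, mul_one, ← sub_eq_add_neg, Real.cosh_sub_sinh]
  simp only [e, Finset.sum_add_distrib, ← Finset.mul_sum, sum_eq_zero hI]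
  simp only [Finset.sum_const, Finset.card_univ, nsmul_eq_mul, mul_zero, add_zero]
  gcongr
  exact Real.cosh_le_exp_half_sq c

/-- By Cauchy–Schwarz, `hc` keeps the exponent in `[-1, 1]`, where `exp u ≤ 1 + u + u ^ 2`. The
linear term averages to zero and orthogonality evaluates the quadratic one. -/
theorem sum_exp_sum_le {ι : Type*} [Fintype ι] {S : ι → Finset (Fin d)}
    (hS : Function.Injective S) (hne : ∀ i, (S i).Nonempty) (c : ι → ℝ)
    (hc : Fintype.card ι * ∑ i, c i ^ 2 ≤ 1) :
    ∑ y, Real.exp (∑ i, c i * parity (S i) y) ≤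
      Fintype.card (Fin d → ℤˣ) * Real.exp (∑ i, c i ^ 2) := by
  classical
  have hq : ∀ y, |∑ i, c i * parity (S i) y| ≤ 1 := fun y => by
    rw [← sq_le_one_iff_abs_le_one]
    have h2 : ∀ i, (c i * parity (S i) y) ^ 2 = c i ^ 2 := fun i => by
      rcases eq_one_or (S i) y with h | h <;> rw [h] <;> ring
    have := sq_sum_le_card_mul_sum_sq (s := Finset.univ) (f := fun i => c i * parity (S i) y)
    simp only [h2, Finset.card_univ] at this
    exact this.trans hc
  have h1 : ∑ y, ∑ i, c i * parity (S i) y = 0 := by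
    rw [Finset.sum_comm]
    simp [← Finset.mul_sum, sum_eq_zero (hne _)]
  have h2 : ∑ y, (∑ i, c i * parity (S i) y) ^ 2 =
      Fintype.card (Fin d → ℤˣ) * ∑ i, c i ^ 2 := by
    simp only [sq, Finset.sum_mul_sum]
    rw [Finset.sum_comm, Finset.mul_sum]
    refine Finset.sum_congr rfl fun i _ => ?_
    rw [Finset.sum_comm, Finset.sum_eq_single i]
    · have : ∀ y, c i * parity (S i) y * (c i * parity (S i) y) = c i * c i := fun y => by
        rcases eq_one_or (S i) y with h | h <;> rw [h] <;> ring
      simp [this]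
    · intro j _ hj
      have : ∀ y, c i * parity (S i) y * (c j * parity (S j) y) =
        c i * c j * (parity (S i) y * parity (S j) y) := fun y => by ring
      simp only [this, ← Finset.mul_sum, sum_mul_eq_zero (hS.ne (Ne.symm hj)), mul_zero]
    · simp
  calc ∑ y, Real.exp (∑ i, c i * parity (S i) y)
      ≤ ∑ y, (1 + ∑ i, c i * parity (S i) y + (∑ i, c i * parity (S i) y) ^ 2) := by
        refine Finset.sum_le_sum fun y _ => ?_
        have := (abs_le.1 (Real.abs_exp_sub_one_sub_id_le (hq y))).2
        linarith
    _ = Fintype.card (Fin d → ℤˣ) * (∑ i, c i ^ 2 + 1) := by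
        rw [Finset.sum_add_distrib, Finset.sum_add_distrib, h1, h2]
        simp only [Finset.sum_const, Finset.card_univ, nsmul_eq_mul]
        ring
    _ ≤ _ := by
        gcongr
        exact Real.add_one_le_exp _

end parity

/-! ### Change of measure at the leaves. -/

theorem sub_sq_le_log_one_add {t : ℝ} (ht : |t| ≤ 1 / 3) : t - t ^ 2 ≤ Real.log (1 + t) := by
  have h := Real.abs_log_sub_add_sum_range_le (x := -t) (by rw [abs_neg]; linarith) 2
  simp only [Finset.sum_range_succ, Finset.sum_range_zero, abs_neg, sub_neg_eq_add] at h
  have h1 := (abs_le.1 h).1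
  -- This holds exactly up to `|t| = 1 / 3`, the source of the ratio bound used throughout.
  have h2 : |t| ^ (2 + 1) / (1 - |t|) ≤ t ^ 2 / 2 := by
    rw [div_le_iff₀ (by linarith), pow_succ, sq_abs]
    nlinarith [mul_le_mul_of_nonneg_left ht (sq_nonneg t)]
  norm_num at h1
  linarith

namespace ProtocolTree

variable {m : ℕ} {X : Type v}

/-- The pointwise form of the change-of-measure inequality behind Pinsker's inequality. -/
theorem leaf_inequality {p q : Fin m → ℝ} (hp : ∀ j, 0 < p j)
    (hpq : ∀ j, |q j - p j| ≤ 1 / 3 * p j) {e : ℝ} (he : e = 0 ∨ e = 1) :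
    ∏ j, p j - ∏ j, q j + (1 / 2 * ((∏ j, q j) * e) - Real.log 2 * ((∏ j, p j) * e)) +
        ∑ j, (q j - p j) * ∏ i ∈ Finset.univ.erase j, p i ≤
      (∏ j, p j) * ∑ j, ((q j - p j) / p j) ^ 2 := by
  set t : Fin m → ℝ := fun j => (q j - p j) / p j with ht
  have hq : ∀ j, q j = p j * (1 + t j) := fun j => by
    have := (hp j).ne'
    simp only [ht]; field_simp; ring
  have ht2 : ∀ j, |t j| ≤ 1 / 3 := fun j => by
    simp only [ht, abs_div, abs_of_pos (hp j)]
    rw [div_le_iff₀ (hp j)]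
    exact hpq j
  have hpos : ∀ j, 0 < 1 + t j := fun j => by linarith [(abs_le.1 (ht2 j)).1]
  have hP : 0 < ∏ j, p j := Finset.prod_pos fun j _ => hp j
  have hY : 0 < ∏ j, (1 + t j) := Finset.prod_pos fun j _ => hpos j
  have hlin : ∀ j, (q j - p j) * ∏ i ∈ Finset.univ.erase j, p i = (∏ j, p j) * t j := fun j => by
    rw [← Finset.mul_prod_erase _ p (Finset.mem_univ j), hq]
    ring
  have hprod : ∏ j, q j = (∏ j, p j) * ∏ j, (1 + t j) := by
    rw [← Finset.prod_mul_distrib]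
    exact Finset.prod_congr rfl fun j _ => hq j
  have hlog : ∑ j, t j - ∑ j, t j ^ 2 ≤ Real.log (∏ j, (1 + t j)) := by
    rw [Real.log_prod fun j _ => (hpos j).ne', ← Finset.sum_sub_distrib]
    exact Finset.sum_le_sum fun j _ => sub_sq_le_log_one_add (ht2 j)
  simp only [hlin, ← Finset.mul_sum]
  rw [hprod]
  generalize ∏ j, (1 + t j) = y at *
  -- For `e = 0` this is `log y ≤ y - 1`. For `e = 1` the same bound is applied to `y / 2`, which
  -- produces the coefficient `1 / 2` and the `log 2`.
  have key : 1 - y + (1 / 2 * (y * e) - Real.log 2 * e) + ∑ j, t j ≤ ∑ j, t j ^ 2 := by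
    rcases he with rfl | rfl
    · linarith [Real.log_le_sub_one_of_pos hY]
    · have := Real.log_le_sub_one_of_pos (half_pos hY)
      rw [Real.log_div hY.ne' (by norm_num)] at this
      linarith
  nlinarith [mul_le_mul_of_nonneg_left key hP.le]

variable [Fintype X] {ι : Type w} [Fintype ι] [DecidableEq ι]

/-- If no event carries much information about the index under a single input, then a protocol in
which few bits are sent does not identify the index. -/
theorem sum_outputSum_le {P : X → ℝ} {q : ι → X → ℝ} {κ : ℝ} (hκ : 0 ≤ κ)
    (hP : ∀ x, 0 < P x) (hP1 : ∑ x, P x = 1) (hq1 : ∀ i, ∑ x, q i x = 1)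
    (hratio : ∀ i x, |q i x - P x| ≤ 1 / 3 * P x)
    (hinfo : ∀ A : Finset X, A.Nonempty →
      ∑ i, ((∑ x ∈ A, q i x - ∑ x ∈ A, P x) / ∑ x ∈ A, P x) ^ 2 ≤
        κ * -Real.log (∑ x ∈ A, P x))
    (T : ProtocolTree m X ι) :
    ∑ i, outputSum (fun o => if o = i then 1 else 0) T (fun _ => q i) ≤
      2 * Real.log 2 * (1 + κ * bitsSum T fun _ => P) := by
  have hA : ∀ i (A : Finset X), |∑ x ∈ A, q i x - ∑ x ∈ A, P x| ≤ 1 / 3 * ∑ x ∈ A, P x := by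
    intro i A
    rw [← Finset.sum_sub_distrib, Finset.mul_sum]
    exact (Finset.abs_sum_le_sum_abs _ _).trans (Finset.sum_le_sum fun x _ => hratio i x)
  set U : Fin m → Finset X := fun _ => Finset.univ with hU
  have hroot : ∀ (v : Fin m → X → ℝ) (g : ι → ℝ),
      leafSum (fun A o => (∏ j, ∑ x ∈ A j, v j x) * g o) T U = outputSum g T v := by
    intro v g
    rw [leafSum_prod, hU, Fintype.piFinset_univ]
    rfl
  have hone : ∀ (v : Fin m → X → ℝ),
      outputSum (fun _ : ι => (1 : ℝ)) T v = ∏ j, ∑ x, v j x := by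
    intro v
    have := Finset.prod_univ_sum (fun _ : Fin m => (Finset.univ : Finset X)) v
    rw [Fintype.piFinset_univ] at this
    simp only [outputSum, mul_one, this]
  have hi : ∀ i, 1 / 2 * outputSum (fun o => if o = i then 1 else 0) T (fun _ => q i) -
      Real.log 2 * outputSum (fun o => if o = i then 1 else 0) T (fun _ => P) ≤
      leafSum (fun A _ => (∏ j, ∑ x ∈ A j, P x) *
        ∑ j, ((∑ x ∈ A j, q i x - ∑ x ∈ A j, P x) / ∑ x ∈ A j, P x) ^ 2) T U := by
    intro i
    -- The linear terms of `leaf_inequality` are leaf masses of these signed products. Their `j`-th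
    -- factor has total mass zero, so they cancel over the leaves (`r3`).
    set w : Fin m → Fin m → X → ℝ := fun j =>
      Function.update (fun _ => P) j (fun x => q i x - P x) with hw
    have hwA : ∀ j (A : Fin m → Finset X), ∏ l, ∑ x ∈ A l, w j l x =
        (∑ x ∈ A j, q i x - ∑ x ∈ A j, P x) * ∏ l ∈ Finset.univ.erase j, ∑ x ∈ A l, P x := by
      intro j A
      rw [← Finset.mul_prod_erase _ _ (Finset.mem_univ j)]
      congr 1
      · simp only [hw, Function.update_self, Finset.sum_sub_distrib]
      · refine Finset.prod_congr rfl fun l hl => ?_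
        simp only [hw, Function.update_of_ne (Finset.ne_of_mem_erase hl)]
    have hle := leafSum_mono
      (f := fun A o => (((((∏ j, ∑ x ∈ A j, P x) * 1) +
        (-1) * ((∏ j, ∑ x ∈ A j, q i x) * 1)) +
        (1 / 2) * ((∏ j, ∑ x ∈ A j, q i x) * if o = i then 1 else 0)) +
        (-Real.log 2) * ((∏ j, ∑ x ∈ A j, P x) * if o = i then 1 else 0)) +
        ∑ j, (∏ l, ∑ x ∈ A l, w j l x) * 1)
      (g := fun A _ => (∏ j, ∑ x ∈ A j, P x) *
        ∑ j, ((∑ x ∈ A j, q i x - ∑ x ∈ A j, P x) / ∑ x ∈ A j, P x) ^ 2)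
      (fun A o => by
        by_cases hne : ∀ j, (A j).Nonempty
        · have := leaf_inequality (p := fun j => ∑ x ∈ A j, P x) (q := fun j => ∑ x ∈ A j, q i x)
            (fun j => Finset.sum_pos (fun x _ => hP x) (hne j)) (fun j => hA i (A j))
            (e := if o = i then 1 else 0) (by split_ifs <;> simp)
          simp only [hwA, mul_one]
          linarith
        -- At a leaf reached by no input, every product mass has an empty factor and both sides
        -- vanish.
        · push Not at hne
          obtain ⟨j, hj⟩ := hne
          have hz : ∀ v : Fin m → X → ℝ, ∏ l, ∑ x ∈ A l, v l x = 0 := fun v =>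
            Finset.prod_eq_zero (Finset.mem_univ j) (by rw [hj]; simp)
          simp [hz])
      T U
    rw [leafSum_add, leafSum_add, leafSum_add, leafSum_add, leafSum_sum, leafSum_const_mul,
      leafSum_const_mul, leafSum_const_mul] at hle
    have r1 := hroot (fun _ => P)
    have r2 := hroot (fun _ => q i)
    rw [r1 (fun _ => 1), r1 (fun o => if o = i then 1 else 0), r2 (fun _ => 1),
      r2 (fun o => if o = i then 1 else 0)] at hle
    have r3 : ∀ j, leafSum (fun A (_ : ι) => (∏ l, ∑ x ∈ A l, w j l x) * 1) T U = 0 := by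
      intro j
      rw [hroot (w j) (fun _ => 1), hone]
      refine Finset.prod_eq_zero (Finset.mem_univ j) ?_
      simp only [hw, Function.update_self, Finset.sum_sub_distrib, hq1, hP1, sub_self]
    simp only [r3, hone, hP1, hq1, Finset.prod_const_one, Finset.sum_const_zero] at hle
    linarith
  have hsum := Finset.sum_le_sum fun i (_ : i ∈ Finset.univ) => hi i
  rw [Finset.sum_sub_distrib, ← Finset.mul_sum, ← Finset.mul_sum, ← leafSum_sum] at hsum
  have hPout : ∑ i, outputSum (fun o => if o = i then (1 : ℝ) else 0) T (fun _ => P) = 1 := by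
    simp only [outputSum]
    rw [Finset.sum_comm]
    simp [sum_prod_eq_one (v := fun _ : Fin m => P) fun _ => hP1]
  have hent := leafSum_negMulLog_le (fun _ => P) (fun _ x => (hP x).le) T U
  have hmono := leafSum_mono
    (f := fun A (_ : ι) => ∑ i, (∏ j, ∑ x ∈ A j, P x) *
        ∑ j, ((∑ x ∈ A j, q i x - ∑ x ∈ A j, P x) / ∑ x ∈ A j, P x) ^ 2)
    (g := fun A _ => κ * Real.negMulLog (∏ j, ∑ x ∈ A j, P x))
    (fun A o => by
      by_cases hne : ∀ j, (A j).Nonempty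
      · have hpos : ∀ j, 0 < ∑ x ∈ A j, P x := fun j =>
          Finset.sum_pos (fun x _ => hP x) (hne j)
        -- The logarithm turns the product mass of the rectangle into a sum over parties, so the
        -- one-party bounds `hinfo` add up to the entropy term of the leaf.
        rw [← Finset.mul_sum, Finset.sum_comm, Real.negMulLog,
          Real.log_prod fun j _ => (hpos j).ne']
        have := Finset.sum_le_sum fun j (_ : j ∈ Finset.univ) => hinfo (A j) (hne j)
        rw [← Finset.mul_sum, Finset.sum_neg_distrib] at this
        have := mul_le_mul_of_nonneg_left this
          (Finset.prod_nonneg fun j (_ : j ∈ Finset.univ) => (hpos j).le)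
        linarith
      · push Not at hne
        obtain ⟨j, hj⟩ := hne
        have hz : ∏ l, ∑ x ∈ A l, P x = 0 :=
          Finset.prod_eq_zero (Finset.mem_univ j) (by rw [hj]; simp)
        simp [hz])
    T U
  rw [leafSum_const_mul] at hmono
  have hbits : ∑ x ∈ Fintype.piFinset U, (∏ j, P (x j)) * (T.bitsSent x : ℝ) =
      bitsSum T fun _ => P := by
    rw [hU, Fintype.piFinset_univ]; rfl
  have hroot0 : Real.negMulLog (∏ j, ∑ x ∈ U j, P x) = 0 := by simp [hU, hP1]
  rw [hbits, hroot0, zero_add] at hent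
  have := mul_le_mul_of_nonneg_left hent hκ
  rw [hPout] at hsum
  linarith

end ProtocolTree

/-! ### Conditional means and tails from exponential moments. -/

section Information

variable {X ι : Type*} [Fintype X] [Fintype ι]

/-- The conditional means of functions with Gaussian exponential moments, given an event, are small
unless the event is improbable. -/
theorem sum_sq_average_le {f : ι → X → ℝ} {a L t : ℝ} (ha : 0 < a) (hL : 0 < L)
    (haL : Fintype.card ι * L ≤ a) (hf : ∀ i x, |f i x| ≤ t)
    (hexp : ∀ b : ι → ℝ, L * ∑ i, b i ^ 2 ≤ 1 →
      ∑ x, Real.exp (∑ i, b i * f i x) ≤ Fintype.card X * Real.exp (a * ∑ i, b i ^ 2))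
    {A : Finset X} (hA : A.Nonempty) :
    ∑ i, ((∑ x ∈ A, f i x) / A.card) ^ 2 ≤
      (4 * a + t ^ 2) * -Real.log (A.card / Fintype.card X) := by
  have hA0 : (0 : ℝ) < A.card := by exact_mod_cast hA.card_pos
  have hX0 : (0 : ℝ) < Fintype.card X := by
    exact_mod_cast hA.card_pos.trans_le (Finset.card_le_univ A)
  set δ : ι → ℝ := fun i => (∑ x ∈ A, f i x) / A.card with hδ
  set D := ∑ i, δ i ^ 2 with hD
  set ℓ := -Real.log (A.card / Fintype.card X) with hℓ
  have hD0 : 0 ≤ D := Finset.sum_nonneg fun i _ => sq_nonneg _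
  have hℓ0 : 0 ≤ ℓ := by
    rw [hℓ, neg_nonneg]
    exact Real.log_nonpos (by positivity)
      ((div_le_one hX0).2 (by exact_mod_cast Finset.card_le_univ A))
  -- Jensen's inequality on `A` for the combination with weights `c * δ i`; enlarging the sum from
  -- `A` to all of `X` costs the factor whose logarithm is `ℓ`.
  have main : ∀ c : ℝ, L * (c ^ 2 * D) ≤ 1 → c * D ≤ ℓ + a * (c ^ 2 * D) := by
    intro c hc
    have hb : ∑ i, (c * δ i) ^ 2 = c ^ 2 * D := by
      simp only [mul_pow, ← Finset.mul_sum, hD]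
    have h1 := hexp (fun i => c * δ i) (by rw [hb]; exact hc)
    rw [hb] at h1
    have h2 := convexOn_exp.map_sum_le (t := A) (w := fun _ => (A.card : ℝ)⁻¹)
      (p := fun x => ∑ i, c * δ i * f i x) (fun _ _ => by positivity)
      (by simp [hA0.ne']) (fun _ _ => Set.mem_univ _)
    simp only [smul_eq_mul, ← Finset.mul_sum] at h2
    have h3 : (A.card : ℝ)⁻¹ * ∑ x ∈ A, ∑ i, c * δ i * f i x = c * D := by
      rw [Finset.sum_comm, hD, Finset.mul_sum, Finset.mul_sum]
      refine Finset.sum_congr rfl fun i _ => ?_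
      rw [← Finset.mul_sum, sq]
      nth_rw 3 [hδ]
      simp only
      ring
    have h4 : ∑ x ∈ A, Real.exp (∑ i, c * δ i * f i x) ≤
        Fintype.card X * Real.exp (a * (c ^ 2 * D)) :=
      (Finset.sum_le_univ_sum_of_nonneg fun x => (Real.exp_pos _).le).trans h1
    rw [h3] at h2
    have h5 : Real.exp (c * D) ≤
        (A.card : ℝ)⁻¹ * (Fintype.card X * Real.exp (a * (c ^ 2 * D))) :=
      h2.trans (by gcongr)
    have h6 : (A.card : ℝ)⁻¹ * (Fintype.card X * Real.exp (a * (c ^ 2 * D))) =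
        Real.exp (ℓ + a * (c ^ 2 * D)) := by
      rw [Real.exp_add, hℓ, Real.exp_neg, Real.exp_log (by positivity), inv_div]
      ring
    rw [h6] at h5
    exact Real.exp_le_exp.1 h5
  -- The optimal `c = 1 / (2 * a)` is admissible in `main` exactly in this case; otherwise the
  -- largest admissible `c` is taken.
  by_cases hc : L * D ≤ 4 * a ^ 2
  · have h := main (1 / (2 * a)) (by
      rw [show L * ((1 / (2 * a)) ^ 2 * D) = L * D / (4 * a ^ 2) by field_simp; ring]
      exact (div_le_one (by positivity)).2 hc)
    have e : 1 / (2 * a) * D - a * ((1 / (2 * a)) ^ 2 * D) = D / (4 * a) := by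
      field_simp; ring
    have h2 : D / (4 * a) ≤ ℓ := by linarith
    rw [div_le_iff₀ (by positivity)] at h2
    nlinarith [mul_nonneg (sq_nonneg t) hℓ0]
  · push Not at hc
    have hLD : 0 < L * D := lt_trans (by positivity) hc
    set r := Real.sqrt (L * D) with hr
    have hr0 : 0 < r := Real.sqrt_pos.2 hLD
    have hr2 : r ^ 2 = L * D := Real.sq_sqrt hLD.le
    have hra : 2 * a ≤ r := Real.le_sqrt_of_sq_le (by nlinarith)
    have e1 : (1 / r) ^ 2 * D = 1 / L := by
      rw [div_pow, hr2, one_pow]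
      have hD1 : D ≠ 0 := right_ne_zero_of_mul hLD.ne'
      field_simp
    have h := main (1 / r) (by rw [e1, mul_one_div_cancel hL.ne'])
    rw [e1] at h
    have e2 : 1 / r * D = r / L := by
      field_simp
      rw [hr2]; ring
    rw [e2] at h
    -- When `D` is this large, `A` is so improbable that the trivial bound `D ≤ card ι * t ^ 2`
    -- suffices. This is the use of `haL`.
    have h3 : (Fintype.card ι : ℝ) ≤ ℓ := by
      have h4 : (2 * a - a) / L ≤ r / L - a * (1 / L) := by
        rw [mul_one_div, ← sub_div]
        gcongr
      have h5 : (Fintype.card ι : ℝ) ≤ (2 * a - a) / L := by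
        rw [le_div_iff₀ hL]; linarith
      linarith
    have hδt : ∀ i, δ i ^ 2 ≤ t ^ 2 := fun i => by
      rw [← sq_abs]
      refine pow_le_pow_left₀ (abs_nonneg _) ?_ 2
      rw [hδ, abs_div, abs_of_pos hA0, div_le_iff₀ hA0]
      calc |∑ x ∈ A, f i x| ≤ ∑ x ∈ A, |f i x| := Finset.abs_sum_le_sum_abs _ _
        _ ≤ ∑ x ∈ A, t := Finset.sum_le_sum fun x _ => hf i x
        _ = t * A.card := by rw [Finset.sum_const, nsmul_eq_mul, mul_comm]
    have h6 : D ≤ Fintype.card ι * t ^ 2 := by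
      calc D ≤ ∑ i : ι, t ^ 2 := Finset.sum_le_sum fun i _ => hδt i
        _ = _ := by rw [Finset.sum_const, nsmul_eq_mul, Finset.card_univ]
    nlinarith [mul_le_mul_of_nonneg_right h3 (sq_nonneg t), mul_nonneg ha.le hℓ0]

/-- The two-sided exponential Markov inequality for a uniform random variable. -/
theorem sum_ite_lt_abs_le {f : X → ℝ} {s c K : ℝ} (hs : 0 ≤ s)
    (h1 : ∑ x, Real.exp (s * f x) ≤ K) (h2 : ∑ x, Real.exp (-s * f x) ≤ K) :
    ∑ x, (if c < |f x| then (1 : ℝ) else 0) ≤ 2 * K * Real.exp (-(s * c)) := by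
  calc ∑ x, (if c < |f x| then (1 : ℝ) else 0)
      ≤ ∑ x, (Real.exp (s * f x) + Real.exp (-s * f x)) * Real.exp (-(s * c)) := by
        refine Finset.sum_le_sum fun x _ => ?_
        split_ifs with h
        · have h3 : 1 ≤ Real.exp (s * |f x|) * Real.exp (-(s * c)) := by
            rw [← Real.exp_add]
            refine Real.one_le_exp ?_
            nlinarith [mul_le_mul_of_nonneg_left h.le hs]
          have h4 : Real.exp (s * |f x|) ≤ Real.exp (s * f x) + Real.exp (-s * f x) := by
            rcases abs_cases (f x) with ⟨h, -⟩ | ⟨h, -⟩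
            · rw [h]; linarith [Real.exp_pos (-s * f x)]
            · rw [h, mul_neg, neg_mul]; linarith [Real.exp_pos (s * f x)]
          exact h3.trans (mul_le_mul_of_nonneg_right h4 (Real.exp_pos _).le)
        · positivity
    _ = (∑ x, Real.exp (s * f x) + ∑ x, Real.exp (-s * f x)) * Real.exp (-(s * c)) := by
        rw [← Finset.sum_mul, Finset.sum_add_distrib]
    _ ≤ 2 * K * Real.exp (-(s * c)) := by
        gcongr
        linarith

end Information

/-! ### Stopped likelihood ratios of parity-biased samples. -/

section Correlation

variable {d : ℕ} {ρ θ θ' : ℝ}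

theorem cast_card_fin_fun (n : ℕ) (Y : Type*) [Fintype Y] :
    (Fintype.card (Fin n → Y) : ℝ) = (Fintype.card Y : ℝ) ^ n := by
  rw [Fintype.card_fun, Fintype.card_fin, Nat.cast_pow]

theorem sum_prod_one_add_parity {I : Finset (Fin d)} (hI : I.Nonempty) (ρ : ℝ) (n : ℕ) :
    ∑ x : Fin n → Fin d → ℤˣ, ∏ l, (1 + ρ * parity I (x l)) =
      Fintype.card (Fin n → Fin d → ℤˣ) := by
  have := Finset.prod_univ_sum (fun _ : Fin n => (Finset.univ : Finset (Fin d → ℤˣ)))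
    (fun _ y => 1 + ρ * parity I y)
  rw [Fintype.piFinset_univ] at this
  rw [← this, cast_card_fin_fun n (Fin d → ℤˣ), Finset.sum_add_distrib, ← Finset.mul_sum, parity.sum_eq_zero hI]
  simp

/-- The stopped likelihood ratio of a sample with parity bias `ρ` on `I`. -/
noncomputable def parityRatio (ρ θ : ℝ) {n : ℕ} (I : Finset (Fin d)) (x : Fin n → Fin d → ℤˣ) :
    ℝ :=
  stoppedLikelihood ρ θ n (fun l => parity I (x l)) 1

theorem abs_parityRatio_sub_one_le (hρ : 0 ≤ ρ) (hθ : 0 ≤ θ) (hθ' : θ + ρ * (1 + θ) ≤ θ')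
    {n : ℕ} (I : Finset (Fin d)) (x : Fin n → Fin d → ℤˣ) : |parityRatio ρ θ I x - 1| ≤ θ' :=
  stoppedLikelihood.abs_sub_one_le hρ hθ' _ (fun l => (parity.abs_eq I (x l)).le) (by
    rw [sub_self, abs_zero]; nlinarith)

theorem sum_parityRatio {n : ℕ} {I : Finset (Fin d)} (hI : I.Nonempty) :
    ∑ x : Fin n → Fin d → ℤˣ, parityRatio ρ θ I x = Fintype.card (Fin n → Fin d → ℤˣ) := by
  have := stoppedLikelihood.sum_eq (ρ := ρ) (θ := θ) (parity I) (parity.sum_eq_zero hI) n 1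
  rw [mul_one] at this
  rw [cast_card_fin_fun n (Fin d → ℤˣ)]
  exact this

theorem sum_exp_sum_parityRatio_le {ι : Type*} [Fintype ι] {S : ι → Finset (Fin d)}
    (hS : Function.Injective S) (hne : ∀ i, (S i).Nonempty) (hρ : 0 ≤ ρ) (hθ : 0 ≤ θ)
    (hθ1 : θ ≤ 1) (n : ℕ) (b : ι → ℝ) (hb : 4 * ρ ^ 2 * Fintype.card ι * ∑ i, b i ^ 2 ≤ 1) :
    ∑ x : Fin n → Fin d → ℤˣ, Real.exp (∑ i, b i * (parityRatio ρ θ (S i) x - 1)) ≤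
      Fintype.card (Fin n → Fin d → ℤˣ) * Real.exp (4 * (n * ρ ^ 2) * ∑ i, b i ^ 2) := by
  have h := stoppedLikelihood.sum_exp_le (θ := θ) hρ (fun i => parity (S i)) b
    (K := 4 * ρ ^ 2 * ∑ i, b i ^ 2) (fun c hc => by
      have hc2 : ∑ i, c i ^ 2 ≤ 4 * ρ ^ 2 * ∑ i, b i ^ 2 := by
        rw [Finset.mul_sum]
        refine Finset.sum_le_sum fun i _ => ?_
        have h1 : |c i| ≤ 2 * ρ * |b i| := (hc i).trans (by
          refine mul_le_mul_of_nonneg_right ?_ (abs_nonneg _)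
          nlinarith)
        calc c i ^ 2 = |c i| ^ 2 := (sq_abs _).symm
          _ ≤ (2 * ρ * |b i|) ^ 2 := pow_le_pow_left₀ (abs_nonneg _) h1 2
          _ = 4 * ρ ^ 2 * b i ^ 2 := by rw [mul_pow, sq_abs]; ring
      refine (parity.sum_exp_sum_le hS hne c ?_).trans (by gcongr)
      calc (Fintype.card ι : ℝ) * ∑ i, c i ^ 2
          ≤ Fintype.card ι * (4 * ρ ^ 2 * ∑ i, b i ^ 2) := by gcongr
        _ ≤ 1 := by linarith) hθ n (fun _ => 1)
  have e : ∀ x : Fin n → Fin d → ℤˣ, Real.exp (∑ i, b i * (parityRatio ρ θ (S i) x - 1)) =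
      Real.exp (∑ i, b i * stoppedLikelihood ρ θ n (fun l => parity (S i) (x l)) 1) *
        Real.exp (-∑ i, b i) := fun x => by
    rw [← Real.exp_add, ← sub_eq_add_neg, ← Finset.sum_sub_distrib]
    congr 1
    exact Finset.sum_congr rfl fun i _ => by rw [parityRatio]; ring
  simp only [e, ← Finset.sum_mul]
  refine (mul_le_mul_of_nonneg_right h (Real.exp_pos _).le).trans_eq ?_
  rw [mul_assoc, ← Real.exp_add, cast_card_fin_fun n (Fin d → ℤˣ)]
  congr 2
  simp only [mul_one]
  ring

theorem sum_exp_mul_parityRatio_le {I : Finset (Fin d)} (hI : I.Nonempty) (hρ : 0 ≤ ρ)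
    (hθ : 0 ≤ θ) (hθ1 : θ ≤ 1) (n : ℕ) (s : ℝ) :
    ∑ x : Fin n → Fin d → ℤˣ, Real.exp (s * (parityRatio ρ θ I x - 1)) ≤
      Fintype.card (Fin n → Fin d → ℤˣ) * Real.exp (2 * (n * ρ ^ 2) * s ^ 2) := by
  have h := stoppedLikelihood.sum_exp_le (ι := Unit) (θ := θ) hρ (fun _ => parity I) (fun _ => s)
    (K := 2 * ρ ^ 2 * s ^ 2) (fun c hc => by
      have h1 : |c ()| ≤ 2 * ρ * |s| := (hc ()).trans (by
        refine mul_le_mul_of_nonneg_right ?_ (abs_nonneg _)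
        nlinarith)
      have h2 : c () ^ 2 ≤ 4 * ρ ^ 2 * s ^ 2 :=
        calc c () ^ 2 = |c ()| ^ 2 := (sq_abs _).symm
          _ ≤ (2 * ρ * |s|) ^ 2 := pow_le_pow_left₀ (abs_nonneg _) h1 2
          _ = 4 * ρ ^ 2 * s ^ 2 := by rw [mul_pow, sq_abs]; ring
      simp only [Finset.univ_unique, Finset.sum_singleton]
      refine (parity.sum_exp_mul_le hI _).trans ?_
      gcongr
      change c () ^ 2 / 2 ≤ _
      linarith) hθ n (fun _ => 1)
  simp only [Finset.univ_unique, Finset.sum_singleton] at h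
  have e : ∀ x : Fin n → Fin d → ℤˣ, Real.exp (s * (parityRatio ρ θ I x - 1)) =
      Real.exp (s * stoppedLikelihood ρ θ n (fun l => parity I (x l)) 1) *
        Real.exp (-s) := fun x => by
    rw [← Real.exp_add, parityRatio]
    congr 1
    ring
  simp only [e, ← Finset.sum_mul]
  refine (mul_le_mul_of_nonneg_right h (Real.exp_pos _).le).trans_eq ?_
  rw [mul_assoc, ← Real.exp_add, cast_card_fin_fun n (Fin d → ℤˣ)]
  congr 2
  ring

theorem sum_ite_lt_abs_parityRatio_le {I : Finset (Fin d)} (hI : I.Nonempty) (hρ : 0 < ρ)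
    (hθ : 0 ≤ θ) (hθ1 : θ ≤ 1) {n : ℕ} (hn : 0 < n) :
    ∑ x : Fin n → Fin d → ℤˣ, (if θ < |parityRatio ρ θ I x - 1| then (1 : ℝ) else 0) ≤
      Fintype.card (Fin n → Fin d → ℤˣ) * (2 * Real.exp (-(θ ^ 2 / (8 * (n * ρ ^ 2))))) := by
  have hn' : (0 : ℝ) < n := by exact_mod_cast hn
  -- This exponent minimizes `2 * (n * ρ ^ 2) * s ^ 2 - s * θ`.
  have h1 := sum_exp_mul_parityRatio_le hI hρ.le hθ hθ1 n (θ / (4 * (n * ρ ^ 2)))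
  have h2 := sum_exp_mul_parityRatio_le hI hρ.le hθ hθ1 n (-(θ / (4 * (n * ρ ^ 2))))
  rw [neg_sq] at h2
  refine (sum_ite_lt_abs_le (c := θ) (by positivity) h1 h2).trans_eq ?_
  rw [mul_assoc, mul_assoc, ← Real.exp_add, ← mul_assoc, mul_comm (2 : ℝ), mul_assoc]
  congr 3
  field_simp
  ring

/-- Stopping the likelihood ratio hardly decreases expectations of functions into `[0, 1]`. -/
theorem sum_likelihood_mul_le {I : Finset (Fin d)} (hI : I.Nonempty) (hρ : 0 < ρ) (hρ1 : ρ ≤ 1)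
    (hθ : 0 ≤ θ) (hθ1 : θ ≤ 1) (hθ' : θ + ρ * (1 + θ) ≤ θ') {n : ℕ} (hn : 0 < n)
    (f : (Fin n → Fin d → ℤˣ) → ℝ) (hf0 : ∀ x, 0 ≤ f x) (hf1 : ∀ x, f x ≤ 1) :
    ∑ x, (∏ l, (1 + ρ * parity I (x l))) * f x ≤ ∑ x, parityRatio ρ θ I x * f x +
      Fintype.card (Fin n → Fin d → ℤˣ) *
        ((1 + θ') * (2 * Real.exp (-(θ ^ 2 / (8 * (n * ρ ^ 2)))))) := by
  have hL : ∀ x : Fin n → Fin d → ℤˣ, 0 ≤ ∏ l, (1 + ρ * parity I (x l)) := fun x =>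
    Finset.prod_nonneg fun l _ => by
      rcases parity.eq_one_or I (x l) with h | h <;> rw [h] <;> linarith
  have hθ'0 : 0 ≤ θ' := le_trans (by positivity) hθ'
  -- Both densities have the same total, so the loss on `f` equals the gain on `1 - f`. There the
  -- true likelihood enters only through its nonnegativity, and its upper tail needs no bound.
  have hpt : ∀ x : Fin n → Fin d → ℤˣ,
      (parityRatio ρ θ I x - ∏ l, (1 + ρ * parity I (x l))) * (1 - f x) ≤
        (1 + θ') * if θ < |parityRatio ρ θ I x - 1| then (1 : ℝ) else 0 := by
    intro x
    have hR := (abs_le.1 (abs_parityRatio_sub_one_le hρ.le hθ hθ' I x)).2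
    split_ifs with h
    · have h1 : 0 ≤ 1 - f x := sub_nonneg.2 (hf1 x)
      calc (parityRatio ρ θ I x - ∏ l, (1 + ρ * parity I (x l))) * (1 - f x)
          ≤ (1 + θ') * (1 - f x) := by
            refine mul_le_mul_of_nonneg_right ?_ h1
            linarith [hL x]
        _ ≤ (1 + θ') * 1 := by
            refine mul_le_mul_of_nonneg_left ?_ (by linarith)
            linarith [hf0 x]
    · have := stoppedLikelihood.eq_prod (fun l => parity I (x l)) (not_lt.1 h)
      rw [parityRatio, this]
      simp
  have hsum := Finset.sum_le_sum fun x (_ : x ∈ Finset.univ) => hpt x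
  rw [← Finset.mul_sum] at hsum
  have htail := mul_le_mul_of_nonneg_left
    (sum_ite_lt_abs_parityRatio_le hI hρ hθ hθ1 hn) (by linarith : 0 ≤ 1 + θ')
  have e : ∑ x : Fin n → Fin d → ℤˣ,
      (parityRatio ρ θ I x - ∏ l, (1 + ρ * parity I (x l))) * (1 - f x) =
      (∑ x, (∏ l, (1 + ρ * parity I (x l))) * f x - ∑ x, parityRatio ρ θ I x * f x) +
      (∑ x : Fin n → Fin d → ℤˣ, parityRatio ρ θ I x - ∑ x : Fin n → Fin d → ℤˣ, ∏ l, (1 + ρ * parity I (x l))) := by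
    simp only [← Finset.sum_sub_distrib, ← Finset.sum_add_distrib]
    exact Finset.sum_congr rfl fun x _ => by ring
  rw [e, sum_parityRatio hI, sum_prod_one_add_parity hI] at hsum
  linarith

end Correlation

/-! ### Sampling laws as finite sums. -/

section CorrMeasure

variable {d : ℕ}

theorem corrMeasure_singleton (ρ : ℝ) (I : Finset (Fin d)) (y : Fin d → ℤˣ) :
    corrMeasure ρ I {y} = ENNReal.ofReal ((2 : ℝ)⁻¹ ^ d * (1 + ρ * parity I y)) := by
  rw [corrMeasure, withDensity_apply _ (measurableSet_singleton y), lintegral_singleton,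
    Measure.count_singleton, mul_one]
  rfl

instance isFiniteMeasure_corrMeasure (ρ : ℝ) (I : Finset (Fin d)) :
    IsFiniteMeasure (corrMeasure ρ I) := by
  refine ⟨?_⟩
  rw [← Finset.coe_univ, ← sum_measure_singleton]
  exact ENNReal.sum_lt_top.2 fun y _ => by
    rw [corrMeasure_singleton]; exact ENNReal.ofReal_lt_top

theorem card_units_pow (d n : ℕ) :
    (Fintype.card (Fin n → Fin d → ℤˣ) : ℝ)⁻¹ = ∏ _l : Fin n, (2 : ℝ)⁻¹ ^ d := by
  rw [cast_card_fin_fun n (Fin d → ℤˣ), cast_card_fin_fun d ℤˣ]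
  simp

theorem pi_corrMeasure_real_singleton {ρ : ℝ} (hρ : 0 ≤ ρ) (hρ1 : ρ ≤ 1) (I : Finset (Fin d))
    {n : ℕ} (x : Fin n → Fin d → ℤˣ) :
    (Measure.pi fun _ : Fin n => corrMeasure ρ I).real {x} =
      (Fintype.card (Fin n → Fin d → ℤˣ) : ℝ)⁻¹ * ∏ l, (1 + ρ * parity I (x l)) := by
  rw [measureReal_def, Measure.pi_singleton, ENNReal.toReal_prod, card_units_pow,
    ← Finset.prod_mul_distrib]
  refine Finset.prod_congr rfl fun l _ => ?_
  rw [corrMeasure_singleton, ENNReal.toReal_ofReal]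
  refine mul_nonneg (by positivity) ?_
  rcases parity.eq_one_or I (x l) with h | h <;> rw [h] <;> linarith

theorem pi_pi_corrMeasure_real {ι : Type w} [DecidableEq ι] {m n : ℕ} {ρ : ℝ} (hρ : 0 ≤ ρ)
    (hρ1 : ρ ≤ 1) (I : Finset (Fin d)) (T : ProtocolTree m (Fin n → Fin d → ℤˣ) ι) (i : ι) :
    (Measure.pi fun _ : Fin m => Measure.pi fun _ : Fin n => corrMeasure ρ I).real
        {x | T.output x = i} =
      T.outputSum (fun o => if o = i then 1 else 0) fun _ x =>
        (Fintype.card (Fin n → Fin d → ℤˣ) : ℝ)⁻¹ * ∏ l, (1 + ρ * parity I (x l)) := by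
  have : {x | T.output x = i} = ((Finset.univ.filter fun x => T.output x = i : Finset _) :
      Set (Fin m → Fin n → Fin d → ℤˣ)) := by ext; simp
  rw [this, ← sum_measureReal_singleton, Finset.sum_filter, ProtocolTree.outputSum]
  refine Finset.sum_congr rfl fun x _ => ?_
  split_ifs
  · rw [measureReal_def, Measure.pi_singleton, ENNReal.toReal_prod, mul_one]
    refine Finset.prod_congr rfl fun j _ => ?_
    rw [← pi_corrMeasure_real_singleton hρ hρ1]
    rfl
  · rw [mul_zero]

end CorrMeasure

/-! ### The bound for deterministic protocols. -/

namespace ProtocolTree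

variable {m n d : ℕ} {X : Type v} {O : Type w}

theorem bitsSum_le [Fintype X] {v : Fin m → X → ℝ} (hv : ∀ j x, 0 ≤ v j x)
    (hv1 : ∀ j, ∑ x, v j x = 1) {T : ProtocolTree m X O} {B : ℕ} (hB : ∀ x, T.bitsSent x ≤ B) :
    bitsSum T v ≤ B := by
  calc bitsSum T v ≤ ∑ x : Fin m → X, (∏ j, v j (x j)) * (B : ℝ) := by
        refine Finset.sum_le_sum fun x _ => mul_le_mul_of_nonneg_left ?_
          (Finset.prod_nonneg fun j _ => hv j _)
        exact_mod_cast hB x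
    _ = B := by rw [← Finset.sum_mul, sum_prod_eq_one hv1, one_mul]

/-- A deterministic protocol in which at most `B` bits are sent identifies few parity biases. -/
theorem sum_outputSum_parity_le {ι : Type w} [Fintype ι] [DecidableEq ι]
    {S : ι → Finset (Fin d)} (hS : Function.Injective S) (hne : ∀ i, (S i).Nonempty)
    {ρ θ θ' : ℝ} (hρ : 0 < ρ) (hρ1 : ρ ≤ 1) (hθ : 0 ≤ θ) (hθ1 : θ ≤ 1)
    (hθ' : θ + ρ * (1 + θ) ≤ θ') (hθ'1 : θ' ≤ 1 / 3) (hn : 0 < n) (hι : 0 < Fintype.card ι)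
    (hcard : (Fintype.card ι : ℝ) ^ 2 ≤ n)
    (T : ProtocolTree m (Fin n → Fin d → ℤˣ) ι) {B : ℕ} (hB : ∀ x, T.bitsSent x ≤ B) :
    ∑ i, T.outputSum (fun o => if o = i then 1 else 0) (fun _ x =>
        (Fintype.card (Fin n → Fin d → ℤˣ) : ℝ)⁻¹ * ∏ l, (1 + ρ * parity (S i) (x l))) ≤
      2 * Real.log 2 * (1 + (16 * (n * ρ ^ 2) + θ' ^ 2) * B) +
        Fintype.card ι *
          ((1 + θ') * (2 * Real.exp (-(θ ^ 2 / (8 * (n * ρ ^ 2))))) * B) := by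
  set N : ℝ := ((Fintype.card (Fin n → Fin d → ℤˣ) : ℕ) : ℝ) with hN
  have hN0 : 0 < N := by rw [hN]; exact_mod_cast Fintype.card_pos
  have hn' : (0 : ℝ) < n := by exact_mod_cast hn
  have hι' : (0 : ℝ) < Fintype.card ι := by exact_mod_cast hι
  set η := (1 + θ') * (2 * Real.exp (-(θ ^ 2 / (8 * (n * ρ ^ 2))))) with hη
  have hθ'0 : 0 ≤ θ' := le_trans (by positivity) hθ'
  have hη0 : 0 ≤ η := by positivity
  set P : (Fin n → Fin d → ℤˣ) → ℝ := fun _ => N⁻¹ with hP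
  set p : ι → (Fin n → Fin d → ℤˣ) → ℝ := fun i x =>
    N⁻¹ * ∏ l, (1 + ρ * parity (S i) (x l)) with hp
  set q : ι → (Fin n → Fin d → ℤˣ) → ℝ := fun i x => N⁻¹ * parityRatio ρ θ (S i) x with hq
  have hR : ∀ i (x : Fin n → Fin d → ℤˣ), |parityRatio ρ θ (S i) x - 1| ≤ θ' := fun i x =>
    abs_parityRatio_sub_one_le hρ.le hθ hθ' _ _
  have hP1 : ∑ x, P x = 1 := by
    simp only [hP, Finset.sum_const, Finset.card_univ, nsmul_eq_mul]
    exact mul_inv_cancel₀ hN0.ne'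
  have hp1 : ∀ i, ∑ x, p i x = 1 := fun i => by
    simp only [hp, ← Finset.mul_sum, sum_prod_one_add_parity (hne i)]
    exact inv_mul_cancel₀ hN0.ne'
  have hq1 : ∀ i, ∑ x, q i x = 1 := fun i => by
    simp only [hq, ← Finset.mul_sum, sum_parityRatio (hne i)]
    exact inv_mul_cancel₀ hN0.ne'
  have hp0 : ∀ i x, 0 ≤ p i x := fun i x => by
    refine mul_nonneg (by positivity) (Finset.prod_nonneg fun l _ => ?_)
    rcases parity.eq_one_or (S i) (x l) with h | h <;> rw [h] <;> linarith
  have hq0 : ∀ i x, 0 ≤ q i x := fun i x =>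
    mul_nonneg (by positivity) (by linarith [(abs_le.1 (hR i x)).1])
  have hhyb : ∀ i, T.outputSum (fun o => if o = i then 1 else 0) (fun _ => p i) ≤
      T.outputSum (fun o => if o = i then 1 else 0) (fun _ => q i) + η * B := fun i => by
    have h := outputSum_le_outputSum_add (p := p i) (q := q i) hη0 (hp0 i) (hq0 i) (hp1 i) (hq1 i)
      (fun f hf0 hf1 => by
        have := sum_likelihood_mul_le (hne i) hρ hρ1 hθ hθ1 hθ' hn f hf0 hf1
        have := mul_le_mul_of_nonneg_left this (inv_pos.2 hN0).le
        rw [mul_add, Finset.mul_sum, Finset.mul_sum, ← hN, inv_mul_cancel_left₀ hN0.ne'] at this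
        simp only [hp, hq, mul_assoc] at this ⊢
        exact this)
      (g := fun o => if o = i then 1 else 0)
      (fun o => by split_ifs <;> norm_num) (fun o => by split_ifs <;> norm_num) T
      (fun _ => p i) (fun _ => q i) (fun _ => Or.inr ⟨rfl, rfl⟩)
    have hb := bitsSum_le (v := fun _ : Fin m => p i) (fun _ => hp0 i) (fun _ => hp1 i) hB
    nlinarith [mul_le_mul_of_nonneg_left hb hη0]
  have hinfo := sum_outputSum_le (P := P) (q := q) (κ := 16 * (n * ρ ^ 2) + θ' ^ 2)
    (by positivity) (fun _ => inv_pos.2 hN0) hP1 hq1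
    (fun i x => by
      have e : q i x - P x = (parityRatio ρ θ (S i) x - 1) * N⁻¹ := by simp only [hq, hP]; ring
      rw [e, abs_mul, abs_of_pos (inv_pos.2 hN0)]
      exact mul_le_mul_of_nonneg_right ((hR i x).trans hθ'1) (inv_pos.2 hN0).le)
    (fun A hA => by
      have hA0 : (0 : ℝ) < A.card := by exact_mod_cast hA.card_pos
      have h := sum_sq_average_le (f := fun i (x : Fin n → Fin d → ℤˣ) =>
          parityRatio ρ θ (S i) x - 1) (a := 4 * (n * ρ ^ 2))
        (L := 4 * ρ ^ 2 * Fintype.card ι) (t := θ') (by positivity) (by positivity)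
        -- For these `a` and `L`, the condition `card ι * L ≤ a` amounts to `(card ι) ^ 2 ≤ n`.
        (by nlinarith [mul_le_mul_of_nonneg_left hcard (sq_nonneg ρ)]) hR
        (fun b hb => sum_exp_sum_parityRatio_le hS hne hρ.le hθ hθ1 n b hb) hA
      have eP : ∑ x ∈ A, P x = A.card / N := by
        simp only [hP, Finset.sum_const, nsmul_eq_mul, div_eq_mul_inv]
      have eq : ∀ i, ((∑ x ∈ A, q i x - ∑ x ∈ A, P x) / ∑ x ∈ A, P x) =
          (∑ x ∈ A, (parityRatio ρ θ (S i) x - 1)) / A.card := fun i => by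
        rw [← Finset.sum_sub_distrib, eP]
        have : ∀ x, q i x - P x = N⁻¹ * (parityRatio ρ θ (S i) x - 1) := fun x => by
          simp only [hq, hP]; ring
        simp only [this, ← Finset.mul_sum]
        field_simp
      rw [Finset.sum_congr rfl fun i _ => congrArg (· ^ 2) (eq i), eP]
      refine h.trans_eq ?_
      rw [hN]; ring) T
  have hb := bitsSum_le (v := fun _ : Fin m => P) (fun _ _ => (inv_pos.2 hN0).le)
    (fun _ => hP1) hB
  have hlog := Real.log_nonneg (one_le_two : (1 : ℝ) ≤ 2)
  calc ∑ i, T.outputSum (fun o => if o = i then 1 else 0) (fun _ => p i)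
      ≤ ∑ i, (T.outputSum (fun o => if o = i then 1 else 0) (fun _ => q i) + η * B) :=
        Finset.sum_le_sum fun i _ => hhyb i
    _ = ∑ i, T.outputSum (fun o => if o = i then 1 else 0) (fun _ => q i) +
          Fintype.card ι * (η * B) := by
        rw [Finset.sum_add_distrib, Finset.sum_const, Finset.card_univ, nsmul_eq_mul]
    _ ≤ _ := by
        gcongr
        refine hinfo.trans ?_
        gcongr

end ProtocolTree

/-! ### Randomized protocols and the choice of parameters. -/

/-- By averaging, a randomized protocol that identifies all members of a family has deterministic
instances that do so on average. -/
theorem RandomizedProtocol.Identifies.card_mul_le {m n : ℕ} {Ω : Type v} [MeasurableSpace Ω]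
    {ι : Type w} [Fintype ι] {π : RandomizedProtocol.{u, v, w} m (Fin n → Ω) ι}
    {μ : ι → Measure Ω} [∀ i, IsFiniteMeasure (μ i)] {ε c : ℝ} (h : π.Identifies μ ε) (hc : 0 ≤ c)
    (hle : ∀ s, ∑ i, (Measure.pi fun _ : Fin m => Measure.pi fun _ : Fin n => μ i).real
      {x | (π.tree s).output x = i} ≤ c) :
    Fintype.card ι * (1 - ε) ≤ c := by
  set ν : ι → Measure (Fin m → Fin n → Ω) := fun i =>
    Measure.pi fun _ : Fin m => Measure.pi fun _ : Fin n => μ i with hν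
  have h1 : ∑ i, (π.seedLaw.prod (ν i)) {p | (π.tree p.1).output p.2 = i} ≤
      ENNReal.ofReal c := by
    calc ∑ i, (π.seedLaw.prod (ν i)) {p | (π.tree p.1).output p.2 = i}
        = ∑ i, ∫⁻ s, ν i {x | (π.tree s).output x = i} ∂π.seedLaw :=
          Finset.sum_congr rfl fun i _ => Measure.prod_apply (π.measurableSet_output i)
      _ = ∫⁻ s, ∑ i, ν i {x | (π.tree s).output x = i} ∂π.seedLaw :=
          (lintegral_finsetSum _ fun i _ =>
            measurable_measure_prodMk_left (π.measurableSet_output i)).symm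
      _ ≤ ∫⁻ _, ENNReal.ofReal c ∂π.seedLaw := by
          refine lintegral_mono fun s => ?_
          have hfin : ∀ i ∈ Finset.univ, ν i {x | (π.tree s).output x = i} ≠ ⊤ :=
            fun i _ => measure_ne_top _ _
          rw [ENNReal.le_ofReal_iff_toReal_le (ENNReal.sum_ne_top.2 hfin) hc,
            ENNReal.toReal_sum hfin]
          exact hle s
      _ = ENNReal.ofReal c := by simp
  have h2 : ∑ i, (π.seedLaw.prod (ν i)).real {p | (π.tree p.1).output p.2 = i} ≤ c := by
    have := ENNReal.toReal_mono ENNReal.ofReal_ne_top h1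
    rw [ENNReal.toReal_ofReal hc, ENNReal.toReal_sum fun i _ => measure_ne_top _ _] at this
    exact this
  calc Fintype.card ι * (1 - ε) = ∑ _i : ι, (1 - ε) := by
        rw [Finset.sum_const, Finset.card_univ, nsmul_eq_mul]
    _ ≤ _ := (Finset.sum_le_sum fun i _ => h i).trans h2

theorem three_le_choose {d r : ℕ} (hr : 2 ≤ r) (hrd : r < d) : 3 ≤ d.choose r := by
  obtain ⟨r, rfl⟩ := Nat.exists_eq_add_of_le' hr
  obtain ⟨d, rfl⟩ := Nat.exists_eq_add_of_le' (hr.trans hrd.le)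
  have h1 : 0 < d.choose r := Nat.choose_pos (by omega)
  have h2 : 0 < d.choose (r + 1) := Nat.choose_pos (by omega)
  have h3 : 0 < (d + 1).choose (r + 2) := Nat.choose_pos (by omega)
  have e1 : (d + 2).choose (r + 2) = (d + 1).choose (r + 1) + (d + 1).choose (r + 2) :=
    Nat.choose_succ_succ _ _
  have e2 : (d + 1).choose (r + 1) = d.choose r + d.choose (r + 1) := Nat.choose_succ_succ _ _
  omega

/-- The inequality `log u ≤ u - 1` at `u = 1 / √t`. It makes `t * log (k ^ 2 / t)` small when only
`t * log k` is assumed small. -/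
theorem mul_neg_log_le_two_mul_sqrt {t : ℝ} (ht : 0 < t) : t * -Real.log t ≤ 2 * Real.sqrt t := by
  have hs := Real.sqrt_pos.2 ht
  have h := Real.log_le_sub_one_of_pos (inv_pos.2 hs)
  rw [Real.log_inv, Real.log_sqrt ht.le] at h
  have h2 : t * (Real.sqrt t)⁻¹ = Real.sqrt t := by
    nth_rw 1 [← Real.mul_self_sqrt ht.le]
    rw [mul_assoc, mul_inv_cancel₀ hs.ne', mul_one]
  nlinarith [mul_le_mul_of_nonneg_left h ht.le]

theorem mul_log_sq_div_le {k t : ℝ} (hk : 3 ≤ k) (ht : 0 < t)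
    (hkt : t * Real.log k ≤ 1 / 1000000) :
    t ≤ 1 / 1000000 ∧ 1 ≤ Real.log (k ^ 2 / t) ∧ t * Real.log (k ^ 2 / t) ≤ 1 / 128 := by
  have hk1 : 1 ≤ Real.log k := by
    rw [Real.le_log_iff_exp_le (by linarith)]
    linarith [Real.exp_one_lt_d9]
  have ht1 : t ≤ 1 / 1000000 := (le_mul_of_one_le_right ht.le hk1).trans hkt
  have e : Real.log (k ^ 2 / t) = 2 * Real.log k - Real.log t := by
    rw [Real.log_div (by positivity) ht.ne', Real.log_pow]
    norm_num
  have hlt : Real.log t ≤ 0 := Real.log_nonpos ht.le (by linarith)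
  refine ⟨ht1, by rw [e]; linarith, ?_⟩
  have h1 := mul_neg_log_le_two_mul_sqrt ht
  have h2 : Real.sqrt t ≤ 1 / 1000 := by
    rw [Real.sqrt_le_left (by norm_num)]
    linarith
  rw [e]
  linarith

/-- The information term is at most `2 * log 2 * (1 + k / 25)` and the stopping error at most `1 /
100`. The condition `3 ≤ k` leaves room for the additive `2 * log 2` below `2 * k / 3`. -/
theorem error_bound_lt {k t Λ B ρ θ : ℝ} (hk3 : 3 ≤ k) (ht0 : 0 < t) (hΛ1 : 1 ≤ Λ) (hB0 : 0 ≤ B)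
    (hBt : B * (t * Λ) < k / 1000) (hρ : 0 ≤ ρ) (hρ1 : ρ ≤ 1 / 1000) (hρ2 : ρ ^ 2 ≤ t)
    (hθ0 : 0 ≤ θ) (hθ1 : θ ≤ 1 / 4) (hθ2 : θ ^ 2 = 8 * (t * Λ)) :
    2 * Real.log 2 * (1 + (16 * t + (θ + 2 * ρ) ^ 2) * B) +
      k * ((1 + (θ + 2 * ρ)) * (2 * (t / k ^ 2)) * B) < k * (2 / 3) := by
  have hk0 : 0 < k := by linarith
  have htB : (B : ℝ) * t ≤ B * (t * Λ) :=
    mul_le_mul_of_nonneg_left (le_mul_of_one_le_right ht0.le hΛ1) hB0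
  have h1 : (16 * t + (θ + 2 * ρ) ^ 2) * B ≤ 40 * (k / 1000) := by
    have : (θ + 2 * ρ) ^ 2 ≤ 16 * (t * Λ) + 8 * t := by
      nlinarith [sq_nonneg (θ - 2 * ρ)]
    nlinarith [mul_le_mul_of_nonneg_right this hB0]
  have h2 : k * ((1 + (θ + 2 * ρ)) * (2 * (t / k ^ 2)) * B) ≤ 1 / 100 := by
    have e : k * ((1 + (θ + 2 * ρ)) * (2 * (t / k ^ 2)) * B) =
        2 * (1 + (θ + 2 * ρ)) * (B * t / k) := by
      field_simp
    have h3 : B * t / k ≤ 1 / 1000 := by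
      rw [div_le_iff₀ (by linarith)]
      linarith
    have h4 : 0 ≤ B * t / k := by positivity
    rw [e]
    nlinarith
  have h3 := mul_le_mul_of_nonneg_left h1
    (by linarith [Real.log_nonneg (one_le_two : (1 : ℝ) ≤ 2)] : 0 ≤ 2 * Real.log 2)
  nlinarith [Real.log_two_lt_d9]

/-- The quantitative form: constants are explicit, and `n` need only be at least `k ^ 2`. -/
theorem RandomizedProtocol.Identifies.le_commComplexity {d r m n : ℕ} {ρ : ℝ} (hr : 2 ≤ r)
    (hrd : r < d) (hρ : 0 < ρ)
    (hρn : n * ρ ^ 2 * Real.log (d.choose r : ℝ) ≤ 1 / 1000000) (hn : (d.choose r) ^ 2 ≤ n)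
    {π : RandomizedProtocol.{u, 0, 0} m (Fin n → Fin d → ℤˣ) (OrderSubsets d r)}
    (hπ : π.Identifies (fun I => corrMeasure ρ I.1) (1 / 3)) :
    ENNReal.ofReal ((d.choose r : ℝ) / (1000 * ρ ^ 2 * (n : ℝ) *
      Real.log ((d.choose r : ℝ) ^ 2 / ((n : ℝ) * ρ ^ 2)))) ≤ (π.commComplexity : ℝ≥0∞) := by
  by_contra! hlt
  have hcard : Fintype.card (OrderSubsets d r) = d.choose r := by
    rw [Fintype.card_finset_len, Fintype.card_fin]
  have hk3 : (3 : ℝ) ≤ d.choose r := by exact_mod_cast three_le_choose hr hrd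
  have hnk : ((d.choose r : ℕ) : ℝ) ^ 2 ≤ n := by exact_mod_cast hn
  have hn0 : 0 < n := (Nat.pow_pos (by have := three_le_choose hr hrd; omega)).trans_le hn
  set k : ℝ := ((d.choose r : ℕ) : ℝ) with hk
  have hn1 : (1 : ℝ) ≤ n := by exact_mod_cast hn0
  set t : ℝ := n * ρ ^ 2 with ht
  have ht0 : 0 < t := by positivity
  obtain ⟨ht1, hΛ1, htΛ⟩ := mul_log_sq_div_le hk3 ht0 hρn
  set Λ := Real.log (k ^ 2 / t) with hΛ
  have hΛ0 : 0 < Λ := by linarith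
  have hfin : π.commComplexity ≠ ⊤ := by
    intro htop
    rw [htop] at hlt
    simp at hlt
  obtain ⟨B, hB⟩ := ENat.ne_top_iff_exists.1 hfin
  rw [← hB, ENat.toENNReal_coe, ← ENNReal.ofReal_natCast,
    ENNReal.ofReal_lt_ofReal_iff_of_nonneg (Nat.cast_nonneg B),
    lt_div_iff₀ (by positivity)] at hlt
  have hbits : ∀ s x, (π.tree s).bitsSent x ≤ B := fun s x => by
    have : ((π.tree s).bitsSent x : ℕ∞) ≤ B := by
      rw [hB]
      exact le_iSup₂ (f := fun s x => ((π.tree s).bitsSent x : ℕ∞)) s x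
    exact_mod_cast this
  have hBt : (B : ℝ) * (t * Λ) < k / 1000 := by
    rw [lt_div_iff₀ (by norm_num), ht]
    linarith
  have hρ2 : ρ ^ 2 ≤ t := by rw [ht]; exact le_mul_of_one_le_left (sq_nonneg ρ) hn1
  have hρ1 : ρ ≤ 1 / 1000 := by nlinarith
  -- Chosen so that the tail `exp (-(θ ^ 2 / (8 * t)))` is exactly `t / k ^ 2`: summed over `k`
  -- indices and `B` bits, the stopping error is then of order `B * t / k`.
  set θ := Real.sqrt (8 * (t * Λ)) with hθ
  have hθ2 : θ ^ 2 = 8 * (t * Λ) := Real.sq_sqrt (by positivity)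
  have hθ0 : 0 ≤ θ := Real.sqrt_nonneg _
  have hθ1 : θ ≤ 1 / 4 := by nlinarith
  have hexp : Real.exp (-(θ ^ 2 / (8 * t))) = t / k ^ 2 := by
    have : θ ^ 2 / (8 * t) = Λ := by rw [hθ2]; field_simp
    rw [this, hΛ, Real.exp_neg, Real.exp_log (by positivity), inv_div]
  have hmain := hπ.card_mul_le
    (c := 2 * Real.log 2 * (1 + (16 * t + (θ + 2 * ρ) ^ 2) * B) +
        k * ((1 + (θ + 2 * ρ)) * (2 * (t / k ^ 2)) * B))
    (by
      have := Real.log_nonneg (one_le_two : (1 : ℝ) ≤ 2)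
      positivity)
    (fun s => by
      have h := ProtocolTree.sum_outputSum_parity_le (S := fun I : OrderSubsets d r => I.1)
        Subtype.val_injective
        (fun I => Finset.card_pos.1 (by rw [I.2]; omega)) hρ (by linarith) hθ0
        (by linarith) (θ' := θ + 2 * ρ) (by nlinarith) (by linarith) hn0
        (by rw [hcard]; have := three_le_choose hr hrd; omega) (by rw [hcard]; exact hnk)
        (π.tree s) (hbits s)
      rw [hcard, ← ht, hexp] at h
      refine (Finset.sum_congr rfl fun I _ => ?_).trans_le h
      exact pi_pi_corrMeasure_real hρ.le (by linarith) I.1 (π.tree s) I)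
  rw [hcard, ← hk] at hmain
  exact (error_bound_lt hk3 ht0 hΛ1 (Nat.cast_nonneg B) hBt hρ.le hρ1 hρ2 hθ0 hθ1 hθ2).not_ge
    (by linarith)

theorem mainTheorem8 :
    ∃ C' C'' : ℝ, 0 < C' ∧ 0 < C'' ∧
    ∃ C : ℕ → ℝ, (∀ r, 0 < C r) ∧
    ∃ D : ℕ → ℝ → ℝ, (∀ r ε, 0 < D r ε) ∧
    ∀ (d r m n : ℕ) (ρ : ℝ), 2 ≤ r → r < d → 1 ≤ m →
      0 < ρ → ρ < 1 →
      ρ ≤ ((n : ℝ) * Real.log (d.choose r : ℝ)) ^ (-(1 / 2) : ℝ) / C' →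
      ((d : ℝ) ^ (3 * r) * C r ≤ (n : ℝ) ∨
        (Odd r ∧ ∃ ε : ℝ, 0 < ε ∧ ε < 1 ∧
          (d : ℝ) ^ ((2 + ε) * (r : ℝ)) * D r ε ≤ (n : ℝ))) →
      ∀ π : RandomizedProtocol.{u, 0, 0} m (Fin n → Fin d → ℤˣ) (OrderSubsets d r),
        π.Identifies (fun I => corrMeasure ρ I.1) (1 / 3) →
        ENNReal.ofReal ((d.choose r : ℝ) /
            (C'' * ρ ^ 2 * (n : ℝ) *
              Real.log ((d.choose r : ℝ) ^ 2 / ((n : ℝ) * ρ ^ 2)))) ≤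
          (π.commComplexity : ℝ≥0∞) := by
  refine ⟨1000, 1000, by norm_num, by norm_num, fun _ => 1, fun _ => one_pos, fun _ _ => 1,
    fun _ _ => one_pos, ?_⟩
  intro d r m n ρ hr hrd _ hρ _ hρn hn π hπ
  have hd : (1 : ℝ) ≤ d := by exact_mod_cast (by omega : 1 ≤ d)
  -- Each alternative gives at least the exponent `2 * r`, and `d.choose r ≤ d ^ r` then yields `k ^
  -- 2 ≤ n`.
  have hdn : (d : ℝ) ^ (2 * r) ≤ n := by
    simp only [mul_one] at hn
    rcases hn with h | ⟨-, ε, hε, -, h⟩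
    · exact (pow_le_pow_right₀ hd (by omega)).trans h
    · refine le_trans ?_ h
      rw [← Real.rpow_natCast]
      refine Real.rpow_le_rpow_of_exponent_le hd ?_
      push_cast
      gcongr
      linarith
  have hnk : (d.choose r) ^ 2 ≤ n := by
    have : (d.choose r) ^ 2 ≤ (d ^ r) ^ 2 := Nat.pow_le_pow_left (Nat.choose_le_pow d r) 2
    rw [← pow_mul, mul_comm r] at this
    exact this.trans (by exact_mod_cast hdn)
  have hk3 := three_le_choose hr hrd
  have hn0 : 0 < n := (Nat.pow_pos (by omega)).trans_le hnk
  have hlog : 0 < Real.log (d.choose r : ℝ) :=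
    Real.log_pos (by exact_mod_cast (by omega : 1 < d.choose r))
  have hx : 0 < (n : ℝ) * Real.log (d.choose r : ℝ) := by positivity
  refine hπ.le_commComplexity hr hrd hρ ?_ hnk
  have hsq : (((n : ℝ) * Real.log (d.choose r : ℝ)) ^ (-(1 / 2) : ℝ)) ^ 2 =
      ((n : ℝ) * Real.log (d.choose r : ℝ))⁻¹ := by
    rw [← Real.rpow_natCast, ← Real.rpow_mul hx.le, ← Real.rpow_neg_one]
    norm_num
  -- Squaring the hypothesis on `ρ` turns `C' = 1000` into the bound `1 / 1000000`.
  have h2 := mul_le_mul_of_nonneg_left (pow_le_pow_left₀ hρ.le hρn 2) hx.le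
  rw [div_pow, hsq, ← mul_div_assoc, mul_inv_cancel₀ hx.ne'] at h2
  linarith
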